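/- Let $\lambda$ be Lebesgue measure on $[0,1]$ and $\Delta([0,1])$ the set of Borel probability measures on $[0,1]$. We write $F$ both for a measure in $\Delta([0,1])$ and for its CDF $F(x)=F([0,x])$, and $F^-(t)=\inf\{x\in[0,1] : F(x)\ge t\}$ for $t\in[0,1]$. Let $\mathcal S$ be the set of bidding strategies, i.e. of maps $s:[0,1]\to\Delta([0,1])$ given by a Markov kernel. For $F,H\in\Delta([0,1])$ (the distributions of the buyer's value and of the highest competing bid) and $s\in\mathcal S$ put $$U_F(s,H)=\mathbb E_{(v,h)\sim F\times H}\,\mathbb E_{b\sim s(v)}\big[(v-b)\,\mathbf 1\{b\ge h\}\big],\qquad \widetilde R_F(s,H)=\mathbb E_{h\sim H}\Big[\sup_{s'\in\mathcal S}U_F(s',\delta_h)\Big]-U_F(s,H),$$ the latter being the full-information regret. For a strictly increasing, absolutely continuous $Q:[0,1]\to[0,1]$ and $v\in[0,1]$ let $Y(v)=\{y\in[0,1] : F^-(y)=v\}$, and let $s_Q(v)$ be the Dirac measure at $Q(F(v))$ if $\lambda(Y(v))=0$, and the law of $Q(y)$ with $y$ uniformly distributed on $Y(v)$ if $\lambda(Y(v))>0$.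 Theorem. Let $F\in\Delta([0,1])$ satisfy $F(0)=0$. Then there exist a strictly increasing, absolutely continuous function $Q^*:[0,1]\to[0,1]$ and a distribution $H^*\in\Delta([0,1])$ such that: 1. $Q^*$ solves the initial value problem $$x'(t)=\frac{F^-(t)-x(t)}{1-F(x(t))},\qquad x(0)=0,$$ i.e. $Q^*(0)=0$, $F(Q^*(t))<1$ for all $t\in[0,1]$, and $Q^*$ is differentiable and satisfies the equation at $\lambda$-almost every $t\in[0,1]$; moreover $0<Q^*(y)<F^-(y)$ for all $y\in(0,1]$. 2. $s_{Q^*}\in\mathcal S$, and the CDF of $H^*$ satisfies $$H^*(x)=\exp\Big(-\int_{(Q^*)^{-1}(x)}^1\frac{dt}{1-F(Q^*(t))}\Big)\qquad\text{for all }x\in[0,Q^*(1)]$$ (so that $H^*(Q^*(1))=1$). 3. $(s_{Q^*},H^*)$ is a saddle point of the full-information regret: $\widetilde R_F(s_{Q^*},H)\le\widetilde R_F(s_{Q^*},H^*)\le\widetilde R_F(s,H^*)$ for all $s\in\mathcal S$ and all $H\in\Delta([0,1])$; and $$\inf_{s\in\mathcal S}\ \sup_{H\in\Delta([0,1])}\widetilde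 R_F(s,H)=\widetilde R_F(s_{Q^*},H^*)=\int_0^1Q^*(t)\,dt.$$ -/

import Mathlib

open MeasureTheory ProbabilityTheory

noncomputable section

/-- The cumulative distribution function `[0,1] → [0,1]` of a probability measure on `[0,1]`. -/
def cdfI (F : ProbabilityMeasure unitInterval) (x : unitInterval) : unitInterval :=
  ⟨(F : Measure unitInterval).real (Set.Iic x), measureReal_nonneg, measureReal_le_one⟩

/-- The generalized inverse `F⁻(t) = inf {x ∈ [0,1] | F(x) ≥ t}`. -/
def genInv (F : ProbabilityMeasure unitInterval) (t : unitInterval) : unitInterval :=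
  sInf {x : unitInterval | t ≤ cdfI F x}

/-- Bidding strategies: maps from values to bid distributions that are given by a Markov kernel. -/
def biddingStrategies : Set (unitInterval → Measure unitInterval) :=
  {s | ∃ κ : Kernel unitInterval unitInterval, IsMarkovKernel κ ∧ ∀ v, s v = κ v}

/-- The utility `(v - b) · 1{b ≥ h}` in a first-price auction (ties are won). -/
def utility (b h v : unitInterval) : ℝ :=
  if h ≤ b then (v : ℝ) - (b : ℝ) else 0

/-- The expected utility of the strategy `s` when `(v, h) ∼ F × H` and then `b ∼ s(v)`. -/
def expectedUtility (F : ProbabilityMeasure unitInterval)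
    (s : unitInterval → Measure unitInterval) (H : ProbabilityMeasure unitInterval) : ℝ :=
  ∫ p : unitInterval × unitInterval, (∫ b, utility b p.2 p.1 ∂(s p.1))
    ∂((F : Measure unitInterval).prod (H : Measure unitInterval))

/-- The full-information benchmark: the expectation over `h ∼ H` of the best expected utility
attainable by a strategy that may depend on the realization `h`. -/
def fullInfoBenchmark (F H : ProbabilityMeasure unitInterval) : ℝ :=
  ∫ h, (⨆ s : biddingStrategies, expectedUtility F s (diracProba h)) ∂(H : Measure unitInterval)

/-- The regret with respect to the full-information benchmark. -/
def fullInfoRegret (F : ProbabilityMeasure unitInterval)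
    (s : unitInterval → Measure unitInterval) (H : ProbabilityMeasure unitInterval) : ℝ :=
  fullInfoBenchmark F H - expectedUtility F s H

/-- A function `[0,1] → [0,1]` as a real function, extended to `ℝ` by constants; only its values on
`[0,1]` and its derivatives on `(0,1)` matter below. -/
def realExt (Q : unitInterval → unitInterval) : ℝ → ℝ :=
  Set.IccExtend (zero_le_one (α := ℝ)) (fun t : unitInterval => (Q t : ℝ))

/-- Quantile-based bidding strategies: strictly increasing, absolutely continuous
functions `[0,1] → [0,1]`. -/
structure IsQuantileBased (Q : unitInterval → unitInterval) : Prop where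
  strictMono : StrictMono Q
  absCont : AbsolutelyContinuousOnInterval (realExt Q) 0 1

/-- The set `Y(v)` of quantiles which correspond to the value `v`. -/
def quantilesOf (F : ProbabilityMeasure unitInterval) (v : unitInterval) : Set unitInterval :=
  {y | genInv F y = v}

open Classical in
/-- The bidding strategy that corresponds to `Q`: at the value `v` it bids `Q(F(v))` if
`λ(Y(v)) = 0`, and `Q(y)` with `y` uniformly distributed on `Y(v)` otherwise. -/
def quantileStrategy (F : ProbabilityMeasure unitInterval) (Q : unitInterval → unitInterval)
    (v : unitInterval) : Measure unitInterval :=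
  if (volume : Measure unitInterval) (quantilesOf F v) = 0 then Measure.dirac (Q (cdfI F v))
  else Measure.map Q (ProbabilityTheory.cond (volume : Measure unitInterval) (quantilesOf F v))

/-- `Q` solves the initial value problem `x'(t) = (F⁻(t) - x(t)) / (1 - F(x(t)))`, `x(0) = 0`,
on `[0,1]` in the Carathéodory sense; the denominator is required not to vanish along `Q`. -/
structure SolvesIVP (F : ProbabilityMeasure unitInterval) (Q : unitInterval → unitInterval) :
    Prop where
  init : Q 0 = 0
  absCont : AbsolutelyContinuousOnInterval (realExt Q) 0 1
  denom_pos : ∀ t : unitInterval, (cdfI F (Q t) : ℝ) < 1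
  ode : ∀ᵐ t : unitInterval, HasDerivAt (realExt Q)
    (((genInv F t : ℝ) - (Q t : ℝ)) / (1 - (cdfI F (Q t) : ℝ))) (t : ℝ)

/-- `exp (-∫_{Q⁻¹(x)}^1 dt / (1 - F(Q(t))))`. It is used only for injective `Q` and for `x` in the
range of `Q`, where `Function.invFun Q x` is the unique `y` with `Q y = x`. -/
def competingBidCDF (F : ProbabilityMeasure unitInterval) (Q : unitInterval → unitInterval)
    (x : unitInterval) : ℝ :=
  Real.exp (-∫ t in Set.Icc (Function.invFun Q x) 1, 1 / (1 - (cdfI F (Q t) : ℝ)))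

end

noncomputable section

open Set Filter Topology

/-! Write `q` for the quantile function `F⁻` and `G(x) = ∫₀ˣ (1 - F)`. The equation multiplied by `1
- F(Q)` says `(G ∘ Q)' = q - Q`, so the whole proof works with the integrated form `G(Q(t)) = ∫₀ᵗ (q
- Q)` (`IsIntegratedSolution`), which is insensitive to jumps of `F` and `q`.

Existence. With `z = G ∘ Q` the equation becomes `z' = q - G⁻¹(z)`, whose right side is Lipschitz in
`z` as long as `Q` stays below some `m` with `F(m) < 1`. So `G⁻¹` is cut off at such an `m`, the
truncated equation is solved by Picard–Lindelöf, and an a priori bound on `∫ Q` independent of `m`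
shows that the cutoff is never active once `m` is close to `F⁻(1)` (`clamped_solution_integral`). A
comparison argument gives `Q < q` (`clamped_solution_lt`).

Nature. Against a fixed competing bid `h = Q(τ)` the bidder wins exactly at quantiles `y ≥ τ` and
earns `∫_τ¹ (q - Q) = G(Q(1)) - G(h)`. The benchmark is `E(v - h)⁺ = G(1) - G(h)`. Hence the regret
is the constant `G(1) - G(Q(1)) = ∫ Q` for every `h ≤ Q(1)`, and it is no larger for `h > Q(1)`
(`pointRegret_eq`, `pointRegret_le`).

Buyer. Let `W(t)` be the probability under `H*` that the bid `Q(t)` wins. By construction `W' = W /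
(1 - F(Q))`, and then `((v - Q) W)' = W (v - q) / (1 - F(Q))` (`payoff_sub`). The payoff of value
`v` thus rises while `q ≤ v` and falls afterwards, so every bid in the support of the quantile
strategy is a best response (`payoff_le`). The benchmark does not depend on the strategy, so a best
response minimizes regret. -/

/-! ### A Carathéodory solution of the initial value problem -/

/-- The primitive `x ↦ ∫₀ˣ (1 - f)` of the survival function of `f`. -/
def survivalIntegral (f : ℝ → ℝ) (x : ℝ) : ℝ := ∫ u in (0 : ℝ)..x, (1 - f u)

lemma Monotone.intervalIntegrable_one_sub {f : ℝ → ℝ} (hf : Monotone f) (a b : ℝ) :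
    IntervalIntegrable (fun u => 1 - f u) volume a b :=
  intervalIntegrable_const.sub hf.intervalIntegrable

lemma survivalIntegral_sub {f : ℝ → ℝ} (hf : Monotone f) (x y : ℝ) :
    survivalIntegral f y - survivalIntegral f x = ∫ u in x..y, (1 - f u) :=
  intervalIntegral.integral_interval_sub_left (hf.intervalIntegrable_one_sub _ _)
    (hf.intervalIntegrable_one_sub _ _)

lemma survivalIntegral_sub_le {f : ℝ → ℝ} (hf : Monotone f) (hf0 : ∀ x, 0 ≤ f x) {x y : ℝ}
    (hxy : x ≤ y) : survivalIntegral f y - survivalIntegral f x ≤ y - x := by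
  rw [survivalIntegral_sub hf]
  calc ∫ u in x..y, (1 - f u) ≤ ∫ u in x..y, (1 : ℝ) :=
        intervalIntegral.integral_mono_on hxy (hf.intervalIntegrable_one_sub _ _)
          intervalIntegrable_const fun u _ => by linarith [hf0 u]
    _ = y - x := by simp

/-- The slope of `G` on `(-∞, m]` is at least `1 - f m`; with `f m < 1` this yields injectivity and
the Lipschitz inverse. -/
lemma le_survivalIntegral_sub {f : ℝ → ℝ} (hf : Monotone f) {x y m : ℝ} (hxy : x ≤ y)
    (hym : y ≤ m) : (1 - f m) * (y - x) ≤ survivalIntegral f y - survivalIntegral f x := by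
  rw [survivalIntegral_sub hf]
  calc (1 - f m) * (y - x) = ∫ u in x..y, (1 - f m) := by
        rw [intervalIntegral.integral_const, smul_eq_mul, mul_comm]
    _ ≤ ∫ u in x..y, (1 - f u) :=
        intervalIntegral.integral_mono_on hxy intervalIntegrable_const
          (hf.intervalIntegrable_one_sub _ _)
          fun u hu => by linarith [hf (hu.2.trans hym)]

lemma survivalIntegral_mono {f : ℝ → ℝ} (hf : Monotone f) (hf1 : ∀ x, f x ≤ 1) :
    Monotone (survivalIntegral f) := fun x y hxy => by
  have := le_survivalIntegral_sub hf hxy le_rfl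
  nlinarith [hf1 y]

lemma continuous_survivalIntegral {f : ℝ → ℝ} (hf : Monotone f) :
    Continuous (survivalIntegral f) :=
  intervalIntegral.continuous_primitive (fun a b => hf.intervalIntegrable_one_sub a b) 0

lemma hasDerivAt_survivalIntegral {f : ℝ → ℝ} (hf : Monotone f) {x : ℝ}
    (hx : ContinuousAt f x) : HasDerivAt (survivalIntegral f) (1 - f x) x :=
  intervalIntegral.integral_hasDerivAt_right (hf.intervalIntegrable_one_sub _ _)
    ((measurable_const.sub hf.measurable).stronglyMeasurable.stronglyMeasurableAtFilter)
    (continuousAt_const.sub hx)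

/-- The inverse of `survivalIntegral f` on `[0, m]`, extended by constants. -/
lemma exists_clamped_inverse {f : ℝ → ℝ} (hf : Monotone f) {m : ℝ}
    (hm : 0 ≤ m) (hfm : f m < 1) :
    ∃ (ψ : ℝ → ℝ) (K : NNReal), LipschitzWith K ψ ∧ (∀ z, ψ z ∈ Icc 0 m) ∧
      ∀ z, survivalIntegral f (ψ z) = max 0 (min z (survivalIntegral f m)) := by
  have h0 : survivalIntegral f 0 = 0 := by simp [survivalIntegral]
  have hGm : 0 ≤ survivalIntegral f m := by
    have := le_survivalIntegral_sub hf hm le_rfl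
    nlinarith
  have key : ∀ z, ∃ x ∈ Icc 0 m, survivalIntegral f x = max 0 (min z (survivalIntegral f m)) := by
    intro z
    have := intermediate_value_Icc hm (continuous_survivalIntegral hf).continuousOn
    exact this (by rw [h0]; exact ⟨le_max_left _ _, max_le hGm (min_le_right _ _)⟩)
  choose ψ hψ hG using key
  refine ⟨ψ, Real.toNNReal (1 / (1 - f m)), ?_, hψ, hG⟩
  have hk : 0 < 1 - f m := by linarith
  have aux : ∀ z z', ψ z ≤ ψ z' → ψ z' - ψ z ≤ 1 / (1 - f m) * |z' - z| := by
    intro z z' h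
    have h1 := le_survivalIntegral_sub hf h (hψ z').2
    have h2 : survivalIntegral f (ψ z') - survivalIntegral f (ψ z) ≤ |z' - z| := by
      rw [hG, hG]
      refine (le_abs_self _).trans ((abs_max_sub_max_le_max _ _ _ _).trans ?_)
      refine max_le (by simp) ((abs_min_sub_min_le_max _ _ _ _).trans (by simp))
    rw [div_mul_eq_mul_div, le_div_iff₀ hk]
    linarith
  refine LipschitzWith.of_dist_le_mul fun z z' => ?_
  rw [Real.coe_toNNReal _ (by positivity), Real.dist_eq, Real.dist_eq]
  rcases le_total (ψ z) (ψ z') with h | h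
  · rw [abs_sub_comm, abs_of_nonneg (sub_nonneg.2 h), abs_sub_comm z]
    exact aux _ _ h
  · rw [abs_of_nonneg (sub_nonneg.2 h)]
    exact aux _ _ h

/-- The integral equation `z(t) = ∫₀ᵗ (q - ψ ∘ z)` with monotone `q` and Lipschitz `ψ`. -/
lemma exists_integral_equation {q ψ : ℝ → ℝ} {K : NNReal} (hq : Monotone q)
    (hψ : LipschitzWith K ψ) (hψ01 : ∀ z, ψ z ∈ Icc (0 : ℝ) 1) :
    ∃ z : ℝ → ℝ, Continuous z ∧
      ∀ t ∈ Icc (0 : ℝ) 1, z t = ∫ s in (0 : ℝ)..t, (q s - ψ (z s)) := by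
  have hqi : ∀ a b, IntervalIntegrable q volume a b := fun a b => hq.intervalIntegrable
  set Φ : ℝ → ℝ := fun t => ∫ s in (0 : ℝ)..t, q s with hΦ
  have hΦc : Continuous Φ := intervalIntegral.continuous_primitive hqi 0
  -- The unknown is `w = z - Φ`: its field `-ψ (w + Φ t)` is continuous in `t` even where `q` jumps.
  -- Radius `1` suffices because `|ψ| ≤ 1` and time has length `1`.
  have hPL : IsPicardLindelof (fun t w => -ψ (w + Φ t)) (⟨0, by simp⟩ : Icc (0 : ℝ) 1) (0 : ℝ)
      1 0 1 K := by
    refine ⟨fun t _ => ?_, fun x _ => ?_, fun t _ x _ => ?_, by simp⟩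
    · refine LipschitzWith.lipschitzOnWith (LipschitzWith.of_dist_le_mul fun x y => ?_)
      rw [dist_neg_neg]
      simpa using hψ.dist_le_mul (x + Φ t) (y + Φ t)
    · exact (hψ.continuous.comp (continuous_const.add hΦc)).neg.continuousOn
    · rw [norm_neg, Real.norm_of_nonneg (hψ01 _).1]
      exact (hψ01 _).2
  obtain ⟨w, hw0, hw⟩ := hPL.exists_eq_forall_mem_Icc_hasDerivWithinAt₀
  have hw0 : w 0 = 0 := hw0
  have hwc : ContinuousOn w (Icc 0 1) := fun t ht => (hw t ht).continuousWithinAt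
  have hwe : Continuous (IccExtend (zero_le_one (α := ℝ)) ((Icc (0 : ℝ) 1).domRestrict w)) :=
    (continuousOn_iff_continuous_domRestrict.1 hwc).Icc_extend'
  refine ⟨fun t => IccExtend (zero_le_one (α := ℝ)) ((Icc (0 : ℝ) 1).domRestrict w) t + Φ t,
    hwe.add hΦc, fun t ht => ?_⟩
  have hI : ∀ s ∈ Icc (0 : ℝ) 1,
      IccExtend (zero_le_one (α := ℝ)) ((Icc (0 : ℝ) 1).domRestrict w) s = w s := fun s hs => by
    rw [IccExtend_of_mem _ _ hs]; rfl
  have hcont : Continuous fun s => ψ (IccExtend (zero_le_one (α := ℝ))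
      ((Icc (0 : ℝ) 1).domRestrict w) s + Φ s) := hψ.continuous.comp (hwe.add hΦc)
  rw [intervalIntegral.integral_sub (hqi _ _) (hcont.intervalIntegrable _ _)]
  have hFTC : ∫ s in (0 : ℝ)..t, -ψ (w s + Φ s) = w t - w 0 := by
    refine intervalIntegral.integral_eq_sub_of_hasDeriv_right_of_le ht.1
      (hwc.mono (Icc_subset_Icc_right ht.2)) (fun s hs => ?_) ?_
    · have hs' : s ∈ Ioo (0 : ℝ) 1 := ⟨hs.1, hs.2.trans_le ht.2⟩
      exact ((hw s (Ioo_subset_Icc_self hs')).hasDerivAt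
        (Icc_mem_nhds hs'.1 hs'.2)).hasDerivWithinAt
    · refine ContinuousOn.intervalIntegrable ?_
      rw [uIcc_of_le ht.1]
      exact (hψ.continuous.comp_continuousOn
        ((hwc.mono (Icc_subset_Icc_right ht.2)).add hΦc.continuousOn)).neg
  have hcongr : ∫ s in (0 : ℝ)..t, ψ (IccExtend (zero_le_one (α := ℝ))
      ((Icc (0 : ℝ) 1).domRestrict w) s + Φ s) = ∫ s in (0 : ℝ)..t, ψ (w s + Φ s) := by
    refine intervalIntegral.integral_congr fun s hs => ?_
    rw [uIcc_of_le ht.1] at hs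
    simp only [hI s ⟨hs.1, hs.2.trans ht.2⟩]
  rw [hcongr]
  beta_reduce
  rw [hI t ht]
  rw [intervalIntegral.integral_neg, hw0] at hFTC
  simp only [hΦ]
  linarith

/-- A continuous function with `c - z(s) ≤ L ∫ₛ^τ (c - z)` cannot increase to the level `c`. -/
lemma not_reaches_level {z : ℝ → ℝ} {c L τ : ℝ} (hz : Continuous z) (hτ : 0 < τ)
    (hL : 0 ≤ L) (hlt : ∀ s ∈ Ico 0 τ, z s < c)
    (h : ∀ s ∈ Icc 0 τ, c - z s ≤ ∫ u in s..τ, L * (c - z u)) : False := by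
  -- On `[a, τ]` the integral inequality contracts by `1/2`, so the maximum of `c - z` there cannot
  -- be positive. The `+ 1` covers `L = 0`.
  set a := max 0 (τ - 1 / (2 * (L + 1))) with ha
  have haτ : a < τ := max_lt hτ (by
    have : 0 < 1 / (2 * (L + 1)) := by positivity
    linarith)
  have ha0 : 0 ≤ a := le_max_left _ _
  have hLa : L * (τ - a) ≤ 1 / 2 := by
    have h1 : τ - a ≤ 1 / (2 * (L + 1)) := by linarith [le_max_right 0 (τ - 1 / (2 * (L + 1)))]
    calc L * (τ - a) ≤ L * (1 / (2 * (L + 1))) := mul_le_mul_of_nonneg_left h1 hL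
      _ ≤ 1 / 2 := by
        rw [mul_one_div, div_le_div_iff₀ (by positivity) (by positivity)]; linarith
  obtain ⟨s, hs, hmax⟩ := isCompact_Icc.exists_isMaxOn (nonempty_Icc.2 haτ.le)
    (f := fun u => c - z u) (by fun_prop)
  have hpos : 0 < c - z s := by
    have := hmax (left_mem_Icc.2 haτ.le)
    have h2 := hlt a ⟨ha0, haτ⟩
    simp only [mem_ofPred_eq] at this
    linarith
  have h1 := h s ⟨ha0.trans hs.1, hs.2⟩
  have h2 : ∫ u in s..τ, L * (c - z u) ≤ ∫ u in s..τ, L * (c - z s) := by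
    refine intervalIntegral.integral_mono_on hs.2 (Continuous.intervalIntegrable (by fun_prop) _ _)
      intervalIntegrable_const fun u hu => ?_
    exact mul_le_mul_of_nonneg_left (hmax ⟨hs.1.trans hu.1, hu.2⟩) hL
  simp only [intervalIntegral.integral_const, smul_eq_mul] at h2
  have h3 : (τ - s) * (L * (c - z s)) ≤ 1 / 2 * (c - z s) := by
    have : L * (τ - s) ≤ 1 / 2 :=
      (mul_le_mul_of_nonneg_left (by linarith [hs.1] : τ - s ≤ τ - a) hL).trans hLa
    nlinarith
  linarith

/-- If `ψ (z t) ≥ q t = c`, then `z` has reached the level `g = G(c)` by time `t`. Up to the first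
such time `q ≤ c`, so `z' ≤ c - ψ(z) = ψ(g) - ψ(z) ≤ K (g - z)`, and by `not_reaches_level` such a
`z` stays below `g`. -/
lemma clamped_solution_lt {f q ψ z : ℝ → ℝ} {m : ℝ} {K : NNReal} (hf : Monotone f)
    (hf1 : ∀ x, f x ≤ 1) (hfm : f m < 1) (hq : Monotone q) (hqpos : ∀ t ∈ Ioc (0 : ℝ) 1, 0 < q t)
    (hψ : LipschitzWith K ψ) (hψm : ∀ z, ψ z ∈ Icc 0 m)
    (hG : ∀ z, survivalIntegral f (ψ z) = max 0 (min z (survivalIntegral f m)))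
    (hz : Continuous z) (hzeq : ∀ t ∈ Icc (0 : ℝ) 1, z t = ∫ s in (0 : ℝ)..t, (q s - ψ (z s)))
    {t : ℝ} (ht : t ∈ Ioc (0 : ℝ) 1) : ψ (z t) < q t := by
  by_contra! hcon
  set c := q t with hc
  have hc0 : 0 < c := hqpos t ht
  have hcm : c ≤ m := hcon.trans (hψm _).2
  set g := survivalIntegral f c with hg
  have h0 : survivalIntegral f 0 = 0 := by simp [survivalIntegral]
  have hGmono := survivalIntegral_mono hf hf1
  have hg0 : 0 < g := by
    have := le_survivalIntegral_sub hf hc0.le hcm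
    have : 0 < (1 - f m) * (c - 0) := mul_pos (by linarith) (by linarith)
    linarith
  have hgm : g ≤ survivalIntegral f m := hGmono hcm
  have hψg : ψ g = c := by
    have h1 : survivalIntegral f (ψ g) = g := by rw [hG, min_eq_left hgm, max_eq_right hg0.le]
    have hk : 0 < 1 - f m := by linarith
    rcases le_total (ψ g) c with h | h
    · have := le_survivalIntegral_sub hf h hcm
      rw [h1, ← hg] at this
      nlinarith
    · have := le_survivalIntegral_sub hf h (hψm g).2
      rw [h1, ← hg] at this
      nlinarith
  have hzt : g ≤ z t := by
    have h1 : g ≤ max 0 (min (z t) (survivalIntegral f m)) := (hGmono hcon).trans_eq (hG _)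
    rcases le_max_iff.1 h1 with h | h
    · linarith
    · exact h.trans (min_le_left _ _)
  set S := {s | s ∈ Icc 0 t ∧ g ≤ z s} with hS
  have hScl : IsClosed S := isClosed_Icc.inter (isClosed_le continuous_const hz)
  have hSne : S.Nonempty := ⟨t, ⟨ht.1.le, le_rfl⟩, hzt⟩
  have hSbdd : BddBelow S := ⟨0, fun s hs => hs.1.1⟩
  set τ := sInf S with hτ
  have hτS : τ ∈ S := hScl.csInf_mem hSne hSbdd
  have hz0 : z 0 = 0 := by rw [hzeq 0 (by simp)]; simp
  have hτ0 : 0 < τ := by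
    refine lt_of_le_of_ne hτS.1.1 fun h => ?_
    have := hτS.2
    rw [← h, hz0] at this
    linarith
  have hlt : ∀ s ∈ Ico 0 τ, z s < g := fun s hs => by
    by_contra! h
    exact (csInf_le hSbdd ⟨⟨hs.1, hs.2.le.trans hτS.1.2⟩, h⟩).not_gt hs.2
  have hint : ∀ a b, IntervalIntegrable (fun s => q s - ψ (z s)) volume a b := fun a b =>
    hq.intervalIntegrable.sub ((hψ.continuous.comp hz).intervalIntegrable _ _)
  have hzτ : z τ ≤ g :=
    have : τ ∈ closure (Ico 0 τ) := by rw [closure_Ico hτ0.ne]; exact right_mem_Icc.2 hτ0.le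
    closure_minimal (fun s hs => (hlt s hs).le) (isClosed_le hz continuous_const) this
  refine not_reaches_level hz hτ0 K.2 hlt fun s hs => ?_
  have hτ1 : τ ≤ 1 := hτS.1.2.trans ht.2
  have hdiff : z τ - z s = ∫ u in s..τ, (q u - ψ (z u)) := by
    rw [hzeq τ ⟨hτ0.le, hτ1⟩, hzeq s ⟨hs.1, hs.2.trans hτ1⟩]
    exact intervalIntegral.integral_interval_sub_left (hint _ _) (hint _ _)
  calc g - z s ≤ z τ - z s := by linarith [hτS.2]
    _ = ∫ u in s..τ, (q u - ψ (z u)) := hdiff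
    _ ≤ ∫ u in s..τ, (K : ℝ) * (g - z u) := by
      refine intervalIntegral.integral_mono_on hs.2 (hint _ _)
        (Continuous.intervalIntegrable (by fun_prop) _ _) fun u hu => ?_
      have h1 : q u ≤ c := hq (hu.2.trans hτS.1.2)
      have h2 := hψ.dist_le_mul g (z u)
      have h3 : z u ≤ g := by
        rcases hu.2.lt_or_eq with h | h
        · exact (hlt u ⟨hs.1.trans hu.1, h⟩).le
        · rw [h]; exact hzτ
      rw [Real.dist_eq, Real.dist_eq, hψg, abs_of_nonneg (sub_nonneg.2 h3)] at h2
      linarith [le_abs_self (c - ψ (z u))]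

/-- A lower bound on `ε = ∫ ψ(z)` that does not involve `m`. Since `z ≥ Φ - ε` with `Φ(t) = ∫₀ᵗ q`,
and `G(x) ≤ x`, the solution satisfies `ψ(z) ≥ (Φ - ε) / 2`; integrating over `[0, 1]` gives `3ε ≥ ∫
Φ`. -/
lemma clamped_solution_integral {f q ψ z : ℝ → ℝ} {m M : ℝ} (hf : Monotone f)
    (hf0 : ∀ x, 0 ≤ f x) (hq : Monotone q)
    (hqM : ∀ t ∈ Icc (0 : ℝ) 1, q t ∈ Icc 0 M) (hmM : M / 2 ≤ m) (hfm : f m < 1)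
    (hψ : Continuous ψ) (hψm : ∀ z, ψ z ∈ Icc 0 m)
    (hG : ∀ z, survivalIntegral f (ψ z) = max 0 (min z (survivalIntegral f m)))
    (hz : Continuous z) (hzeq : ∀ t ∈ Icc (0 : ℝ) 1, z t = ∫ s in (0 : ℝ)..t, (q s - ψ (z s))) :
    (∫ t in (0 : ℝ)..1, ∫ s in (0 : ℝ)..t, q s) / 3 ≤ ∫ t in (0 : ℝ)..1, ψ (z t) := by
  have hqi : ∀ a b, IntervalIntegrable q volume a b := fun a b => hq.intervalIntegrable
  have hψi : ∀ a b, IntervalIntegrable (fun t => ψ (z t)) volume a b :=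
    (hψ.comp hz).intervalIntegrable
  have hΦc : Continuous fun t => ∫ s in (0 : ℝ)..t, q s :=
    intervalIntegral.continuous_primitive hqi 0
  set ε := ∫ t in (0 : ℝ)..1, ψ (z t) with hε
  have h0 : survivalIntegral f 0 = 0 := by simp [survivalIntegral]
  have hm : 0 ≤ m := (hψm 0).1.trans (hψm 0).2
  have hlow : ∀ t ∈ Icc (0 : ℝ) 1, ((∫ s in (0 : ℝ)..t, q s) - ε) / 2 ≤ ψ (z t) := by
    intro t ht
    have hzlow : (∫ s in (0 : ℝ)..t, q s) - ε ≤ z t := by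
      rw [hzeq t ht, intervalIntegral.integral_sub (hqi _ _) (hψi _ _)]
      have : ∫ s in (0 : ℝ)..t, ψ (z s) ≤ ε :=
        intervalIntegral.integral_mono_interval le_rfl ht.1 ht.2
          (ae_of_all _ fun s => (hψm _).1) (hψi _ _)
      linarith
    have hε0 : 0 ≤ ε := intervalIntegral.integral_nonneg zero_le_one fun s _ => (hψm _).1
    have hΦM : ∫ s in (0 : ℝ)..t, q s ≤ M := by
      have h1 : ∫ s in (0 : ℝ)..t, q s ≤ ∫ s in (0 : ℝ)..t, M :=
        intervalIntegral.integral_mono_on ht.1 (hqi _ _) intervalIntegrable_const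
          fun s hs => (hqM s ⟨hs.1, hs.2.trans ht.2⟩).2
      have hM : 0 ≤ M := (hqM t ht).1.trans (hqM t ht).2
      have h2 : ∫ s in (0 : ℝ)..t, M = t * M := by simp
      nlinarith [ht.2]
    have hψ0 := (hψm (z t)).1
    have hx := survivalIntegral_sub_le hf hf0 hψ0
    rw [hG, h0] at hx
    rcases le_total (z t) (survivalIntegral f m) with h | h
    · rw [min_eq_left h] at hx
      have := le_max_right 0 (z t)
      rcases le_total 0 ((∫ s in (0 : ℝ)..t, q s) - ε) with h' | h' <;> linarith
    -- Where the cutoff is active, `m ≥ M / 2 ≥ Φ / 2` takes over.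
    · have h1 : ψ (z t) = m := by
        have h2 := le_survivalIntegral_sub hf (hψm (z t)).2 le_rfl
        have h3 : survivalIntegral f m ≤ survivalIntegral f (ψ (z t)) := by
          rw [hG, min_eq_right h]; exact le_max_right _ _
        have h4 : (1 - f m) * (m - ψ (z t)) ≤ 0 := by linarith
        have h5 : m - ψ (z t) ≤ 0 := by
          by_contra! h6
          have := mul_pos (by linarith : 0 < 1 - f m) h6
          linarith
        linarith [(hψm (z t)).2]
      rw [h1]
      linarith
  have hint : ∫ t in (0 : ℝ)..1, ((∫ s in (0 : ℝ)..t, q s) - ε) / 2 ≤ ε :=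
    intervalIntegral.integral_mono_on zero_le_one
      (Continuous.intervalIntegrable (by fun_prop) _ _) (hψi _ _) hlow
  rw [intervalIntegral.integral_div, intervalIntegral.integral_sub
    (hΦc.intervalIntegrable _ _) intervalIntegrable_const] at hint
  simp only [intervalIntegral.integral_const, sub_zero, one_smul] at hint
  linarith

/-- Existence for the initial value problem in the integrated form `G(X(t)) = ∫₀ᵗ (q - X)`. -/
lemma exists_integrated_solution {f q : ℝ → ℝ} {M : ℝ} (hf : Monotone f) (hf0 : ∀ x, 0 ≤ f x)
    (hf1 : ∀ x, f x ≤ 1) (hfM : ∀ x < M, f x < 1) (hM : M ≤ 1) (hq : Monotone q)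
    (hqpos : ∀ t ∈ Ioc (0 : ℝ) 1, 0 < q t) (hqM : ∀ t ∈ Icc (0 : ℝ) 1, q t ∈ Icc 0 M)
    (hGM : ∫ t in (0 : ℝ)..1, q t = survivalIntegral f M) :
    ∃ (X : ℝ → ℝ) (K : NNReal), LipschitzOnWith K X (Icc 0 1) ∧ X 0 = 0 ∧
      StrictMonoOn X (Icc 0 1) ∧ (∀ t ∈ Icc (0 : ℝ) 1, 0 ≤ X t ∧ X t < M) ∧
      (∀ t ∈ Ioc (0 : ℝ) 1, X t < q t) ∧
      ∀ t ∈ Icc (0 : ℝ) 1, survivalIntegral f (X t) = ∫ s in (0 : ℝ)..t, (q s - X s) := by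
  have hqi : ∀ a b, IntervalIntegrable q volume a b := fun a b => hq.intervalIntegrable
  have hM0 : 0 < M := (hqpos 1 (by simp)).trans_le (hqM 1 (by simp)).2
  have hΦc : Continuous fun t => ∫ s in (0 : ℝ)..t, q s :=
    intervalIntegral.continuous_primitive hqi 0
  set c := (∫ t in (0 : ℝ)..1, ∫ s in (0 : ℝ)..t, q s) / 3 with hc
  have hc0 : 0 < c := by
    refine div_pos ?_ (by norm_num)
    refine intervalIntegral.intervalIntegral_pos_of_pos_on (hΦc.intervalIntegrable _ _)
      (fun t ht => ?_) one_pos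
    exact intervalIntegral.intervalIntegral_pos_of_pos_on (hqi _ _)
      (fun s hs => hqpos s ⟨hs.1, hs.2.le.trans ht.2.le⟩) ht.1
  -- `M / 2` is what the a priori bound `c ≤ ∫ ψ(z)` asks for; `M - c` ensures `G(M) - G(m) ≤ c`.
  -- There is no circularity, as `c` depends only on `q`.
  set m := max (M / 2) (M - c) with hm
  have hmM : m < M := max_lt (by linarith) (by linarith)
  have hm0 : 0 ≤ m := le_trans (by linarith) (le_max_left _ _)
  have hfm := hfM m hmM
  obtain ⟨ψ, K, hψ, hψm, hG⟩ := exists_clamped_inverse hf hm0 hfm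
  have hψ01 : ∀ z, ψ z ∈ Icc (0 : ℝ) 1 := fun z => ⟨(hψm z).1, (hψm z).2.trans (hmM.le.trans hM)⟩
  obtain ⟨z, hz, hzeq⟩ := exists_integral_equation hq hψ hψ01
  have hψi : ∀ a b, IntervalIntegrable (fun t => ψ (z t)) volume a b :=
    (hψ.continuous.comp hz).intervalIntegrable
  have hint : ∀ a b, IntervalIntegrable (fun s => q s - ψ (z s)) volume a b := fun a b =>
    hq.intervalIntegrable.sub (hψi _ _)
  have hlt : ∀ t ∈ Ioc (0 : ℝ) 1, ψ (z t) < q t := fun t ht =>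
    clamped_solution_lt hf hf1 hfm hq hqpos hψ hψm hG hz hzeq ht
  have hdiff : ∀ s ∈ Icc (0 : ℝ) 1, ∀ t ∈ Icc (0 : ℝ) 1,
      z t - z s = ∫ u in s..t, (q u - ψ (z u)) := fun s hs t ht => by
    rw [hzeq t ht, hzeq s hs]
    exact intervalIntegral.integral_interval_sub_left (hint _ _) (hint _ _)
  have hzmono : StrictMonoOn z (Icc 0 1) := fun s hs t ht hst => by
    rw [← sub_pos, hdiff s hs t ht]
    exact intervalIntegral.intervalIntegral_pos_of_pos_on (hint _ _)
      (fun u hu => sub_pos.2 (hlt u ⟨hs.1.trans_lt hu.1, hu.2.le.trans ht.2⟩)) hst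
  have hz0 : z 0 = 0 := by rw [hzeq 0 (by simp)]; simp
  -- `z(1) = G(M) - ∫ ψ(z) ≤ G(M) - c ≤ G(m)`: since `z` increases, the cutoff is inactive on all of
  -- `[0, 1]`.
  have hz1 : z 1 ≤ survivalIntegral f m := by
    have h1 := clamped_solution_integral hf hf0 hq hqM (le_max_left _ _) hfm hψ.continuous hψm
      hG hz hzeq
    have h2 := survivalIntegral_sub_le hf hf0 hmM.le
    have h3 : M - c ≤ m := le_max_right _ _
    rw [hzeq 1 (by simp), intervalIntegral.integral_sub (hqi _ _) (hψi _ _), hGM]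
    linarith
  have hGz : ∀ t ∈ Icc (0 : ℝ) 1, survivalIntegral f (ψ (z t)) = z t := fun t ht => by
    have h1 : 0 ≤ z t := hz0 ▸ hzmono.monotoneOn (by simp) ht ht.1
    have h2 : z t ≤ z 1 := hzmono.monotoneOn ht (by simp) ht.2
    rw [hG, min_eq_left (h2.trans hz1), max_eq_right h1]
  have hzlip : LipschitzOnWith 1 z (Icc 0 1) := by
    refine LipschitzOnWith.of_dist_le_mul fun t ht s hs => ?_
    rw [Real.dist_eq, Real.dist_eq, hdiff s hs t ht]
    rw [← Real.norm_eq_abs]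
    refine intervalIntegral.norm_integral_le_of_norm_le_const fun u hu => ?_
    have hu' : u ∈ Icc (0 : ℝ) 1 := by
      have := uIoc_subset_uIcc hu
      rcases le_total s t with h | h
      · rw [uIcc_of_le h] at this; exact ⟨hs.1.trans this.1, this.2.trans ht.2⟩
      · rw [uIcc_of_ge h] at this; exact ⟨ht.1.trans this.1, this.2.trans hs.2⟩
    rw [Real.norm_eq_abs, abs_le]
    simp only [NNReal.coe_one]
    constructor <;> linarith [(hqM u hu').1, (hqM u hu').2, (hψ01 (z u)).1, (hψ01 (z u)).2]
  refine ⟨fun t => ψ (z t), K * 1, hψ.comp_lipschitzOnWith hzlip, ?_, ?_, fun t _ =>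
    ⟨(hψm _).1, (hψm _).2.trans_lt hmM⟩, hlt, fun t ht => by rw [hGz t ht, hzeq t ht]⟩
  · have h1 := le_survivalIntegral_sub hf (hψm (z 0)).1 (hψm (z 0)).2
    have h0 : survivalIntegral f 0 = 0 := by simp [survivalIntegral]
    rw [hGz 0 (by simp), h0, hz0, sub_zero, sub_zero] at h1
    have h2 := (hψm 0).1
    simp only [hz0]
    nlinarith
  · intro s hs t ht hst
    by_contra! h
    have := survivalIntegral_mono hf hf1 h
    rw [hGz s hs, hGz t ht] at this
    exact (hzmono hs ht hst).not_ge this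

/-! ### Distribution functions and quantiles on the unit interval -/

lemma realExt_coe (Q : unitInterval → unitInterval) (t : unitInterval) :
    realExt Q t = Q t := IccExtend_val _ _ t

lemma realExt_of_mem (Q : unitInterval → unitInterval) {t : ℝ} (ht : t ∈ Icc (0 : ℝ) 1) :
    realExt Q t = Q ⟨t, ht⟩ := IccExtend_of_mem _ _ ht

lemma realExt_mem (Q : unitInterval → unitInterval) (t : ℝ) : realExt Q t ∈ Icc (0 : ℝ) 1 :=
  (Q (projIcc 0 1 zero_le_one t)).2

lemma monotone_realExt {Q : unitInterval → unitInterval} (hQ : Monotone Q) :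
    Monotone (realExt Q) :=
  Monotone.IccExtend zero_le_one fun _ _ h => hQ h

lemma continuous_realExt {Q : unitInterval → unitInterval} (hQ : Continuous Q) :
    Continuous (realExt Q) :=
  Continuous.Icc_extend' (continuous_subtype_val.comp hQ)

/-- The distribution function of `F`, regarded as a distribution on the real line. -/
def cdfR (F : ProbabilityMeasure unitInterval) : StieltjesFunction ℝ :=
  cdf ((F : Measure unitInterval).map Subtype.val)

lemma cdfR_eq_real (F : ProbabilityMeasure unitInterval) (x : ℝ) :
    cdfR F x = (F : Measure unitInterval).real {v | (v : ℝ) ≤ x} := by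
  have : IsProbabilityMeasure ((F : Measure unitInterval).map Subtype.val) :=
    Measure.isProbabilityMeasure_map (by fun_prop)
  rw [cdfR, cdf_eq_real, map_measureReal_apply measurable_subtype_coe measurableSet_Iic]
  rfl

lemma cdfR_coe (F : ProbabilityMeasure unitInterval) (x : unitInterval) :
    cdfR F x = cdfI F x := cdfR_eq_real F x

lemma cdfR_nonneg (F : ProbabilityMeasure unitInterval) (x : ℝ) : 0 ≤ cdfR F x := cdf_nonneg _ x

lemma cdfR_le_one (F : ProbabilityMeasure unitInterval) (x : ℝ) : cdfR F x ≤ 1 := cdf_le_one _ x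

lemma monotone_cdfI (F : ProbabilityMeasure unitInterval) : Monotone (cdfI F) := fun x y h => by
  rw [← Subtype.coe_le_coe, ← cdfR_coe, ← cdfR_coe]
  exact (cdfR F).mono h

lemma continuousWithinAt_cdfI (F : ProbabilityMeasure unitInterval) (x : unitInterval) :
    ContinuousWithinAt (cdfI F) (Ici x) x := by
  have h : ContinuousWithinAt (fun x : unitInterval => cdfR F x) (Ici x) x :=
    ((cdfR F).right_continuous x).comp continuous_subtype_val.continuousWithinAt fun y hy => hy
  simp only [cdfR_coe] at h
  exact (Topology.IsInducing.subtypeVal.continuousWithinAt_iff).2 h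

lemma cdfI_one (F : ProbabilityMeasure unitInterval) : cdfI F 1 = 1 := by
  apply Subtype.ext
  have : (Iic (1 : unitInterval)) = univ := Iic_top
  simp [cdfI, this]

/-- Right continuity makes the infimum attained. It is stated for a general `c` because it serves
both `cdfI F` and the distribution function of the competing bid. -/
lemma sInf_le_iff_le_apply {c : unitInterval → unitInterval} (hc : Monotone c)
    (hcr : ∀ x, ContinuousWithinAt c (Ici x) x) (hc1 : c 1 = 1) (t x : unitInterval) :
    sInf {y | t ≤ c y} ≤ x ↔ t ≤ c x := by
  refine ⟨fun h => ?_, fun h => sInf_le h⟩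
  have hne : {y | t ≤ c y}.Nonempty := ⟨1, by
    change t ≤ c 1
    rw [hc1]; exact t.2.2⟩
  have hmem : sInf {y | t ≤ c y} ∈ closure {y | t ≤ c y} :=
    (isGLB_sInf _).mem_closure hne
  have hcont : ContinuousWithinAt c {y | t ≤ c y} (sInf {y | t ≤ c y}) :=
    (hcr _).mono fun y hy => sInf_le hy
  have h1 := hcont.mem_closure_image hmem
  have h2 : closure (c '' {y | t ≤ c y}) ⊆ Ici t :=
    closure_minimal (by rintro _ ⟨y, hy, rfl⟩; exact hy) isClosed_Ici
  exact (h2 h1).trans (hc h)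

lemma genInv_le_iff (F : ProbabilityMeasure unitInterval) (t x : unitInterval) :
    genInv F t ≤ x ↔ t ≤ cdfI F x :=
  sInf_le_iff_le_apply (monotone_cdfI F) (continuousWithinAt_cdfI F) (cdfI_one F) t x

lemma lt_genInv_iff (F : ProbabilityMeasure unitInterval) (t x : unitInterval) :
    x < genInv F t ↔ cdfI F x < t := by
  rw [← not_le, genInv_le_iff, not_le]

lemma monotone_genInv (F : ProbabilityMeasure unitInterval) : Monotone (genInv F) :=
  fun _ _ h => (genInv_le_iff F _ _).2 (h.trans ((genInv_le_iff F _ _).1 le_rfl))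

lemma measurable_genInv (F : ProbabilityMeasure unitInterval) : Measurable (genInv F) :=
  (monotone_genInv F).measurable

lemma map_genInv (F : ProbabilityMeasure unitInterval) :
    (volume : Measure unitInterval).map (genInv F) = F := by
  have : IsProbabilityMeasure ((volume : Measure unitInterval).map (genInv F)) :=
    Measure.isProbabilityMeasure_map (measurable_genInv F).aemeasurable
  refine Measure.ext_of_Iic _ _ fun x => ?_
  rw [Measure.map_apply (measurable_genInv F) measurableSet_Iic]
  have : genInv F ⁻¹' Iic x = Iic (cdfI F x) := by
    ext t; exact genInv_le_iff F t x
  rw [this, unitInterval.volume_Iic]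
  exact ofReal_measureReal

/-! ### Integrals over the unit interval -/

lemma setIntegral_unitInterval_Icc (g : ℝ → ℝ) (a b : unitInterval) (hab : a ≤ b) :
    ∫ t in Icc a b, g t = ∫ t in (a : ℝ)..b, g t := by
  have h1 : (Icc a b : Set unitInterval) = Subtype.val ⁻¹' (Icc (a : ℝ) b) := rfl
  have hab' : (a : ℝ) ≤ b := hab
  rw [h1, unitInterval.measurePreserving_coe.setIntegral_preimage_emb
    unitInterval.measurableEmbedding_coe, Measure.restrict_restrict measurableSet_Icc,
    inter_eq_left.2 (Icc_subset_Icc a.2.1 b.2.2), integral_Icc_eq_integral_Ioc,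
    intervalIntegral.integral_of_le hab']

lemma integral_unitInterval (g : ℝ → ℝ) :
    ∫ t : unitInterval, g t = ∫ t in (0 : ℝ)..1, g t := by
  have := setIntegral_unitInterval_Icc g 0 1 zero_le_one
  have h : (Icc (0 : unitInterval) 1) = univ := Icc_bot_top
  rwa [h, setIntegral_univ] at this

lemma integrable_unitInterval_of_bounded {μ : Measure unitInterval} [IsFiniteMeasure μ]
    {g : unitInterval → ℝ} (hg : Measurable g) {C : ℝ} (hC : ∀ x, |g x| ≤ C) : Integrable g μ :=
  Integrable.of_bound hg.aestronglyMeasurable C (ae_of_all _ hC)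

/-- `E[(v - h)⁺]` is the integral of the survival function over `[h, 1]`. -/
lemma integral_max_sub (F : ProbabilityMeasure unitInterval) (h : unitInterval) :
    ∫ v : unitInterval, max ((v : ℝ) - h) 0 ∂(F : Measure unitInterval) =
      survivalIntegral (cdfR F) 1 - survivalIntegral (cdfR F) h := by
  have hmeas : MeasurableSet {p : unitInterval × ℝ | p.2 < p.1} :=
    measurableSet_lt measurable_snd (measurable_subtype_coe.comp measurable_fst)
  -- Layer cake: `(v - h)⁺ = ∫_h¹ 1{u < v} du`, followed by Fubini.
  have h1 : ∀ v : unitInterval, max ((v : ℝ) - h) 0 =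
      ∫ u in Ioc (h : ℝ) 1, {p : unitInterval × ℝ | p.2 < p.1}.indicator (fun _ => (1 : ℝ)) (v, u) := by
    intro v
    have : (fun u : ℝ => {p : unitInterval × ℝ | p.2 < p.1}.indicator (fun _ => (1 : ℝ)) (v, u)) =
        (Iio (v : ℝ)).indicator fun _ => (1 : ℝ) := by
      ext u; simp [indicator]
    rw [this, setIntegral_indicator measurableSet_Iio]
    have h2 : Ioc (h : ℝ) 1 ∩ Iio (v : ℝ) = Ioo (h : ℝ) v := by
      ext u
      simp only [mem_inter_iff, mem_Ioc, mem_Iio, mem_Ioo]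
      exact ⟨fun hu => ⟨hu.1.1, hu.2⟩, fun hu => ⟨⟨hu.1, hu.2.le.trans v.2.2⟩, hu.2⟩⟩
    rw [h2]
    simp
  have h3 : ∀ u : ℝ, ∫ v : unitInterval,
      {p : unitInterval × ℝ | p.2 < p.1}.indicator (fun _ => (1 : ℝ)) (v, u)
        ∂(F : Measure unitInterval) = 1 - cdfR F u := by
    intro u
    have : (fun v : unitInterval =>
        {p : unitInterval × ℝ | p.2 < p.1}.indicator (fun _ => (1 : ℝ)) (v, u)) =
        {v : unitInterval | (v : ℝ) ≤ u}ᶜ.indicator fun _ => (1 : ℝ) := by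
      ext v; simp [indicator]
    have hm : MeasurableSet {v : unitInterval | (v : ℝ) ≤ u} :=
      measurableSet_le measurable_subtype_coe measurable_const
    rw [this, integral_indicator_const _ hm.compl, cdfR_eq_real,
      probReal_compl_eq_one_sub hm]
    simp
  simp_rw [h1]
  rw [integral_integral_swap]
  · simp_rw [h3]
    rw [survivalIntegral_sub (cdfR F).mono, intervalIntegral.integral_of_le h.2.2]
  · refine Integrable.of_bound (measurable_const.indicator hmeas).aestronglyMeasurable 1
      (ae_of_all _ fun p => ?_)
    simp only [indicator, Function.uncurry]
    split_ifs <;> simp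

lemma integral_genInv_max_sub (F : ProbabilityMeasure unitInterval) (h : unitInterval) :
    ∫ y : unitInterval, max ((genInv F y : ℝ) - h) 0 =
      survivalIntegral (cdfR F) 1 - survivalIntegral (cdfR F) h := by
  rw [← integral_max_sub F h]
  conv_rhs => rw [← map_genInv F]
  rw [integral_map (measurable_genInv F).aemeasurable]
  exact Measurable.aestronglyMeasurable (by fun_prop)

lemma integral_realExt_genInv (F : ProbabilityMeasure unitInterval) :
    ∫ t in (0 : ℝ)..1, realExt (genInv F) t = survivalIntegral (cdfR F) 1 := by
  have h := integral_genInv_max_sub F 0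
  have h0 : survivalIntegral (cdfR F) ((0 : unitInterval) : ℝ) = 0 := by simp [survivalIntegral]
  rw [h0, sub_zero] at h
  rw [← h, ← integral_unitInterval]
  refine integral_congr_ae (ae_of_all _ fun t => ?_)
  simp only [realExt_coe, Set.Icc.coe_zero, sub_zero]
  exact (max_eq_left (genInv F t).2.1).symm

/-! ### The quantile-based strategy -/

/-- The integrated form of the initial value problem, with the properties of its solution. -/
structure IsIntegratedSolution (F : ProbabilityMeasure unitInterval)
    (Q : unitInterval → unitInterval) : Prop where
  zero : Q 0 = 0
  strictMono : StrictMono Q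
  lipschitz : ∃ K, LipschitzOnWith K (realExt Q) (Icc 0 1)
  cdf_lt_one : ∀ t, cdfI F (Q t) < 1
  lt_genInv : ∀ y, 0 < y → Q y < genInv F y
  integral_eq : ∀ t : unitInterval, survivalIntegral (cdfR F) (Q t) =
    ∫ s in (0 : ℝ)..t, (realExt (genInv F) s - realExt Q s)

theorem exists_isIntegratedSolution (F : ProbabilityMeasure unitInterval) (hF : cdfI F 0 = 0) :
    ∃ Q, IsIntegratedSolution F Q := by
  have hltM : ∀ x : unitInterval, x < genInv F 1 → cdfI F x < 1 := fun x => (lt_genInv_iff F 1 x).1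
  have hpos : ∀ t : unitInterval, 0 < t → 0 < genInv F t := fun t ht =>
    (lt_genInv_iff F t 0).2 (by rwa [hF])
  have hfM : ∀ x < (genInv F 1 : ℝ), cdfR F x < 1 := by
    intro x hx
    rcases le_total 0 x with h | h
    · have := hltM ⟨x, h, hx.le.trans (genInv F 1).2.2⟩ hx
      rw [← Subtype.coe_lt_coe, ← cdfR_coe] at this
      exact this
    · refine ((cdfR F).mono h).trans_lt ?_
      have := cdfR_coe F 0
      rw [hF] at this
      simp only [Set.Icc.coe_zero] at this
      rw [this]; exact one_pos
  -- Both sides are the mean of `F`, because `F = 1` on `[F⁻(1), 1]`.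
  have hGM : ∫ t in (0 : ℝ)..1, realExt (genInv F) t =
      survivalIntegral (cdfR F) (genInv F 1) := by
    rw [integral_realExt_genInv, ← sub_eq_zero, survivalIntegral_sub (cdfR F).mono]
    refine (intervalIntegral.integral_congr (g := fun _ => (0 : ℝ)) fun u hu => ?_).trans (by simp)
    rw [uIcc_of_le (genInv F 1).2.2] at hu
    have h1 : (1 : ℝ) ≤ cdfR F (genInv F 1) := by
      rw [cdfR_coe]
      exact (genInv_le_iff F 1 _).1 le_rfl
    have := (cdfR F).mono hu.1
    simp only
    linarith [cdfR_le_one F u]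
  obtain ⟨X, K, hlip, hX0, hmono, hXM, hXq, hXeq⟩ := exists_integrated_solution (cdfR F).mono
    (cdfR_nonneg F) (cdfR_le_one F) hfM (genInv F 1).2.2 (monotone_realExt (monotone_genInv F))
    (fun t ht => by
      rw [realExt_of_mem _ ⟨ht.1.le, ht.2⟩]
      exact hpos _ ht.1)
    (fun t ht => by
      rw [realExt_of_mem _ ht]
      exact ⟨(genInv F _).2.1, monotone_genInv F (Subtype.coe_le_coe.1 ht.2)⟩) hGM
  have hmem : ∀ t : unitInterval, X t ∈ Icc (0 : ℝ) 1 := fun t =>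
    ⟨(hXM t t.2).1, (hXM t t.2).2.le.trans (genInv F 1).2.2⟩
  have hext : ∀ t ∈ Icc (0 : ℝ) 1, realExt (fun t => ⟨X t, hmem t⟩) t = X t := fun t ht =>
    realExt_of_mem _ ht
  refine ⟨fun t => ⟨X t, hmem t⟩, Subtype.ext hX0, fun s t hst => hmono s.2 t.2 hst,
    ⟨K, fun s hs t ht => ?_⟩, fun t => ?_, fun y hy => ?_, fun t => ?_⟩
  · rw [hext s hs, hext t ht]
    exact hlip hs ht
  · exact hltM _ (hXM t t.2).2
  · have := hXq y ⟨hy, y.2.2⟩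
    rwa [realExt_coe] at this
  · refine (hXeq t t.2).trans (intervalIntegral.integral_congr fun s hs => ?_)
    rw [uIcc_of_le t.2.1] at hs
    simp only [hext s ⟨hs.1, hs.2.trans t.2.2⟩]

namespace IsIntegratedSolution

variable {F : ProbabilityMeasure unitInterval} {Q : unitInterval → unitInterval}

lemma continuous (hQ : IsIntegratedSolution F Q) : Continuous Q := by
  obtain ⟨K, hK⟩ := hQ.lipschitz
  rw [continuous_induced_rng]
  have := continuousOn_iff_continuous_domRestrict.1 hK.continuousOn
  exact this.congr fun t => realExt_coe Q t

lemma isQuantileBased (hQ : IsIntegratedSolution F Q) : IsQuantileBased Q := by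
  obtain ⟨K, hK⟩ := hQ.lipschitz
  refine ⟨hQ.strictMono, LipschitzOnWith.absolutelyContinuousOnInterval (K := K) ?_⟩
  rwa [uIcc_of_le zero_le_one]

lemma cdfR_lt_one (hQ : IsIntegratedSolution F Q) (t : ℝ) : cdfR F (realExt Q t) < 1 := by
  have : realExt Q t = Q (projIcc 0 1 zero_le_one t) := rfl
  rw [this, cdfR_coe]
  exact hQ.cdf_lt_one _

/-- The points at which one of the coefficients of the equation may be discontinuous. -/
def exceptionalSet (F : ProbabilityMeasure unitInterval) (Q : unitInterval → unitInterval) :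
    Set ℝ :=
  {t | ¬ContinuousAt (realExt (genInv F)) t} ∪
    {t | t ∈ Icc (0 : ℝ) 1 ∧ ¬ContinuousAt (cdfR F) (realExt Q t)}

/-- Monotone functions have countably many jumps, and the injective `Q` pulls those of `F` back to a
countable set. -/
lemma countable_exceptionalSet (hQ : IsIntegratedSolution F Q) :
    (exceptionalSet F Q).Countable := by
  refine (monotone_realExt (monotone_genInv F)).countable_not_continuousAt.union ?_
  refine MapsTo.countable_of_injOn (f := realExt Q) (fun t ht => ht.2) ?_
    (cdfR F).mono.countable_not_continuousAt
  intro s hs t ht hst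
  rw [realExt_of_mem _ hs.1, realExt_of_mem _ ht.1] at hst
  exact congrArg Subtype.val (hQ.strictMono.injective (Subtype.ext hst))

lemma hasDerivAt_realExt (hQ : IsIntegratedSolution F Q) {t : ℝ}
    (ht : t ∈ Ioo (0 : ℝ) 1 \ exceptionalSet F Q) :
    HasDerivAt (realExt Q)
      ((realExt (genInv F) t - realExt Q t) / (1 - cdfR F (realExt Q t))) t := by
  obtain ⟨ht01, hte⟩ := ht
  have hc1 : ContinuousAt (realExt (genInv F)) t := by
    by_contra h; exact hte (Or.inl h)
  have hc2 : ContinuousAt (cdfR F) (realExt Q t) := by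
    by_contra h; exact hte (Or.inr ⟨Ioo_subset_Icc_self ht01, h⟩)
  have hX := continuous_realExt hQ.continuous
  have hq := monotone_realExt (monotone_genInv F)
  have h1 : HasDerivAt (fun t => ∫ s in (0 : ℝ)..t, (realExt (genInv F) s - realExt Q s))
      (realExt (genInv F) t - realExt Q t) t :=
    intervalIntegral.integral_hasDerivAt_right
      (hq.intervalIntegrable.sub (hX.intervalIntegrable _ _))
      ((hq.measurable.sub hX.measurable).stronglyMeasurable.stronglyMeasurableAtFilter)
      (hc1.sub hX.continuousAt)
  -- The derivative of `G ∘ Q` is known from the integrated equation; dividing it by `G'(Q(t)) = 1 -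
  -- F(Q(t)) > 0` gives that of `Q`.
  refine HasDerivAt.of_comp_left hX.continuousAt
    (hasDerivAt_survivalIntegral (cdfR F).mono hc2) h1 (by linarith [hQ.cdfR_lt_one t]) ?_
  filter_upwards [Icc_mem_nhds ht01.1 ht01.2] with s hs
  have := hQ.integral_eq ⟨s, hs⟩
  rw [← realExt_coe] at this
  exact this

lemma solvesIVP (hQ : IsIntegratedSolution F Q) : SolvesIVP F Q := by
  refine ⟨hQ.zero, hQ.isQuantileBased.absCont, hQ.cdf_lt_one, ?_⟩
  have h : ({t : unitInterval | (t : ℝ) ∈ exceptionalSet F Q ∪ {0, 1}}).Countable :=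
    (hQ.countable_exceptionalSet.union (by simp)).preimage Subtype.val_injective
  filter_upwards [h.ae_notMem volume] with t ht
  have ht' : (t : ℝ) ∉ exceptionalSet F Q ∪ {0, 1} := ht
  simp only [mem_union, mem_insert_iff, mem_singleton_iff, not_or] at ht'
  have := hQ.hasDerivAt_realExt (t := t) ⟨⟨lt_of_le_of_ne t.2.1 (Ne.symm ht'.2.1),
    lt_of_le_of_ne t.2.2 ht'.2.2⟩, ht'.1⟩
  simpa only [realExt_coe, cdfR_coe] using this

lemma pos_and_lt (hQ : IsIntegratedSolution F Q) (y : unitInterval) (hy : 0 < y) :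
    0 < Q y ∧ Q y < genInv F y :=
  ⟨by simpa only [hQ.zero] using hQ.strictMono hy, hQ.lt_genInv y hy⟩

/-! ### The distribution of the highest competing bid -/

/-- The hazard rate `1 / (1 - F(Q(t)))` of the quantile of the highest competing bid. -/
def hazard (F : ProbabilityMeasure unitInterval) (Q : unitInterval → unitInterval) (t : ℝ) : ℝ :=
  1 / (1 - cdfR F (realExt Q t))

/-- The distribution function `exp (-∫ₜ¹ dt / (1 - F(Q(t))))` of the highest competing bid at the
bid `Q(t)`. -/
def winProb (F : ProbabilityMeasure unitInterval) (Q : unitInterval → unitInterval) (t : ℝ) : ℝ :=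
  Real.exp (∫ s in (1 : ℝ)..t, hazard F Q s)

lemma hazard_pos (hQ : IsIntegratedSolution F Q) (t : ℝ) : 0 < hazard F Q t :=
  one_div_pos.2 (sub_pos.2 (hQ.cdfR_lt_one t))

lemma monotone_hazard (hQ : IsIntegratedSolution F Q) : Monotone (hazard F Q) := fun _ t h =>
  one_div_le_one_div_of_le (sub_pos.2 (hQ.cdfR_lt_one t))
    (sub_le_sub_left ((cdfR F).mono (monotone_realExt hQ.strictMono.monotone h)) 1)

lemma intervalIntegrable_hazard (hQ : IsIntegratedSolution F Q) (a b : ℝ) :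
    IntervalIntegrable (hazard F Q) volume a b := hQ.monotone_hazard.intervalIntegrable

lemma continuous_winProb (hQ : IsIntegratedSolution F Q) : Continuous (winProb F Q) :=
  Real.continuous_exp.comp
    (intervalIntegral.continuous_primitive hQ.intervalIntegrable_hazard 1)

lemma winProb_pos (t : ℝ) : 0 < winProb F Q t := Real.exp_pos _

lemma winProb_one : winProb F Q 1 = 1 := by simp [winProb]

lemma monotone_winProb (hQ : IsIntegratedSolution F Q) : Monotone (winProb F Q) := fun s t h => by
  refine Real.exp_le_exp.2 (sub_nonneg.1 ?_)
  rw [intervalIntegral.integral_interval_sub_left (hQ.intervalIntegrable_hazard _ _)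
    (hQ.intervalIntegrable_hazard _ _)]
  exact intervalIntegral.integral_nonneg h fun u _ => (hQ.hazard_pos u).le

lemma hasDerivAt_winProb (hQ : IsIntegratedSolution F Q) {t : ℝ}
    (ht : ContinuousAt (cdfR F) (realExt Q t)) :
    HasDerivAt (winProb F Q) (winProb F Q t * hazard F Q t) t := by
  refine HasDerivAt.exp (intervalIntegral.integral_hasDerivAt_right
    (hQ.intervalIntegrable_hazard _ _)
    (hQ.monotone_hazard.measurable.stronglyMeasurable.stronglyMeasurableAtFilter) ?_)
  have h1 : ContinuousAt (fun t => cdfR F (realExt Q t)) t :=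
    ContinuousAt.comp (f := realExt Q) ht (continuous_realExt hQ.continuous).continuousAt
  exact continuousAt_const.div (continuousAt_const.sub h1) (by linarith [hQ.cdfR_lt_one t])

lemma competingBidCDF_apply (hQ : IsIntegratedSolution F Q) (t : unitInterval) :
    competingBidCDF F Q (Q t) = winProb F Q t := by
  rw [competingBidCDF, Function.leftInverse_invFun hQ.strictMono.injective t, winProb,
    intervalIntegral.integral_symm]
  have := setIntegral_unitInterval_Icc (hazard F Q) t 1 t.2.2
  simp only [hazard, realExt_coe, cdfR_coe, Set.Icc.coe_one] at this
  rw [this]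
  rfl

lemma exists_apply_eq (hQ : IsIntegratedSolution F Q) {x : unitInterval} (hx : x ≤ Q 1) :
    ∃ t, Q t = x :=
  mem_range_of_exists_le_of_exists_ge hQ.continuous
    ⟨0, by rw [hQ.zero]; exact x.2.1⟩ ⟨1, hx⟩

/-- `H` is the law of `Q(c⁻(u))` for uniform `u`, where `c⁻` is the generalized inverse of `c = W`.
Since `W(0) > 0`, this law has an atom at the bid `0`. -/
lemma exists_competingBid (hQ : IsIntegratedSolution F Q) :
    ∃ H : ProbabilityMeasure unitInterval, ∀ t : unitInterval,
      (cdfI H (Q t) : ℝ) = winProb F Q t := by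
  set c : unitInterval → unitInterval := fun t => ⟨winProb F Q t, (winProb_pos _).le,
    (hQ.monotone_winProb t.2.2).trans_eq winProb_one⟩ with hc
  have hcm : Monotone c := fun s t h => hQ.monotone_winProb h
  have hcc : Continuous c := continuous_induced_rng.2
    (hQ.continuous_winProb.comp continuous_subtype_val)
  have hc1 : c 1 = 1 := Subtype.ext winProb_one
  have hiff := sInf_le_iff_le_apply hcm (fun x => hcc.continuousWithinAt) hc1
  have hTm : Monotone fun u => sInf {y | u ≤ c y} := fun u u' h =>
    (hiff u _).2 (h.trans ((hiff u' _).1 le_rfl))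
  have hm : Measurable fun u => Q (sInf {y | u ≤ c y}) :=
    hQ.continuous.measurable.comp hTm.measurable
  refine ⟨⟨(volume : Measure unitInterval).map fun u => Q (sInf {y | u ≤ c y}),
    Measure.isProbabilityMeasure_map hm.aemeasurable⟩, fun t => ?_⟩
  change ((volume : Measure unitInterval).map _).real (Iic (Q t)) = _
  rw [map_measureReal_apply hm measurableSet_Iic]
  have : (fun u => Q (sInf {y | u ≤ c y})) ⁻¹' Iic (Q t) = Iic (c t) := by
    ext u
    simp only [mem_preimage, mem_Iic, hQ.strictMono.le_iff_le]
    exact hiff u t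
  rw [this, measureReal_def, unitInterval.volume_Iic, ENNReal.toReal_ofReal (c t).2.1]

/-! ### Best responses of the buyer -/

lemma intervalIntegrable_winProb_mul (hQ : IsIntegratedSolution F Q) (v a b : ℝ) :
    IntervalIntegrable (fun t => winProb F Q t * (hazard F Q t * (v - realExt (genInv F) t)))
      volume a b := by
  have hmono : Monotone fun t => hazard F Q t * realExt (genInv F) t := fun s t h =>
    mul_le_mul (hQ.monotone_hazard h) (monotone_realExt (monotone_genInv F) h)
      (realExt_mem _ _).1 (hQ.hazard_pos t).le
  have h1 : IntervalIntegrable (fun t => hazard F Q t * (v - realExt (genInv F) t)) volume a b := by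
    refine (((hQ.intervalIntegrable_hazard a b).mul_const v).sub
      hmono.intervalIntegrable).congr fun t _ => ?_
    ring
  exact h1.continuousOn_mul hQ.continuous_winProb.continuousOn

/-- In the derivative of `(v - Q) W` the terms with `Q` cancel, because `Q' = (q - Q) · hazard` and
`W' = W · hazard`. The product is continuous, so the countable exceptional set does not affect the
fundamental theorem of calculus. -/
lemma payoff_sub (hQ : IsIntegratedSolution F Q) (v : ℝ) {a b : ℝ} (ha : 0 ≤ a) (hab : a ≤ b)
    (hb : b ≤ 1) :
    ∫ t in a..b, winProb F Q t * (hazard F Q t * (v - realExt (genInv F) t)) =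
      (v - realExt Q b) * winProb F Q b - (v - realExt Q a) * winProb F Q a := by
  refine integral_eq_of_hasDerivAt_off_countable_of_le (fun t => (v - realExt Q t) * winProb F Q t)
    _ hab hQ.countable_exceptionalSet ?_ (fun t ht => ?_)
    (hQ.intervalIntegrable_winProb_mul v a b)
  · exact ((continuous_const.sub (continuous_realExt hQ.continuous)).mul
      hQ.continuous_winProb).continuousOn
  · have ht' : t ∈ Ioo (0 : ℝ) 1 := ⟨ha.trans_lt ht.1.1, ht.1.2.trans_le hb⟩
    have hc : ContinuousAt (cdfR F) (realExt Q t) := by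
      by_contra h; exact ht.2 (Or.inr ⟨Ioo_subset_Icc_self ht', h⟩)
    have h1 := ((hQ.hasDerivAt_realExt ⟨ht', ht.2⟩).const_sub v).mul (hQ.hasDerivAt_winProb hc)
    refine h1.congr_deriv ?_
    simp only [hazard]
    ring

/-- The payoff `(v - Q(t)) · H(Q(t))` is maximal at every quantile `y` of the value `v`. -/
lemma payoff_le (hQ : IsIntegratedSolution F Q) (v y τ : unitInterval)
    (h1 : ∀ s < y, genInv F s ≤ v) (h2 : ∀ s > y, v ≤ genInv F s) :
    ((v : ℝ) - Q τ) * winProb F Q τ ≤ ((v : ℝ) - Q y) * winProb F Q y := by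
  have hpos : ∀ t, 0 ≤ winProb F Q t * hazard F Q t := fun t =>
    mul_nonneg (winProb_pos _).le (hQ.hazard_pos t).le
  rcases le_total τ y with h | h
  · have h3 := hQ.payoff_sub v τ.2.1 h y.2.2
    rw [realExt_coe, realExt_coe] at h3
    -- The endpoints are dropped because the hypotheses say nothing about `genInv F y`; this admits
    -- `y = F(v)` even if `F⁻(F(v)) ≠ v`.
    rw [← sub_nonneg, ← h3, intervalIntegral.integral_of_le h, integral_Ioc_eq_integral_Ioo]
    refine setIntegral_nonneg measurableSet_Ioo fun t ht => ?_
    have hmem : t ∈ Icc (0 : ℝ) 1 := ⟨τ.2.1.trans ht.1.le, ht.2.le.trans y.2.2⟩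
    rw [← mul_assoc, realExt_of_mem _ hmem]
    exact mul_nonneg (hpos t) (sub_nonneg.2 (h1 ⟨t, hmem⟩ ht.2))
  · have h3 := hQ.payoff_sub v y.2.1 h τ.2.2
    rw [realExt_coe, realExt_coe] at h3
    rw [← sub_nonpos, ← h3, intervalIntegral.integral_of_le h, integral_Ioc_eq_integral_Ioo]
    refine setIntegral_nonpos measurableSet_Ioo fun t ht => ?_
    have hmem : t ∈ Icc (0 : ℝ) 1 := ⟨y.2.1.trans ht.1.le, ht.2.le.trans τ.2.2⟩
    rw [← mul_assoc, realExt_of_mem _ hmem]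
    exact mul_nonpos_of_nonneg_of_nonpos (hpos t) (sub_nonpos.2 (h2 ⟨t, hmem⟩ ht.1))

end IsIntegratedSolution

/-! ### Expected utilities and the full-information benchmark -/

lemma measurable_utility :
    Measurable fun p : unitInterval × unitInterval × unitInterval => utility p.1 p.2.1 p.2.2 := by
  refine Measurable.ite (measurableSet_le (by fun_prop) (by fun_prop)) ?_ measurable_const
  fun_prop

lemma abs_utility_le (b h v : unitInterval) : |utility b h v| ≤ 1 := by
  rw [utility]
  split_ifs
  · rw [abs_le]
    constructor <;> linarith [v.2.1, v.2.2, b.2.1, b.2.2]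
  · simp

lemma isProbabilityMeasure_of_mem {s : unitInterval → Measure unitInterval}
    (hs : s ∈ biddingStrategies) (v : unitInterval) : IsProbabilityMeasure (s v) := by
  obtain ⟨κ, hκ, h⟩ := hs
  rw [h]
  infer_instance

/-- The expectation of a measurable function under a bidding strategy depends measurably on the
value and on parameters. -/
lemma measurable_integral_strategy {α : Type*} [MeasurableSpace α]
    {s : unitInterval → Measure unitInterval} (hs : s ∈ biddingStrategies)
    {g : α → unitInterval → ℝ} {φ : α → unitInterval} (hφ : Measurable φ)
    (hg : Measurable (Function.uncurry g)) : Measurable fun a => ∫ b, g a b ∂(s (φ a)) := by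
  obtain ⟨κ, hκ, h⟩ := hs
  have := StronglyMeasurable.integral_kernel_prod_right' (κ := κ.comap φ hφ) hg.stronglyMeasurable
  simp only [Kernel.comap_apply, Function.uncurry] at this
  simp only [h]
  exact this.measurable

lemma abs_integral_strategy_le {s : unitInterval → Measure unitInterval}
    (hs : s ∈ biddingStrategies) (v : unitInterval) {g : unitInterval → ℝ} {C : ℝ}
    (hg : ∀ b, |g b| ≤ C) : |∫ b, g b ∂(s v)| ≤ C := by
  have := isProbabilityMeasure_of_mem hs v
  have hg' : ∀ b, ‖g b‖ ≤ C := hg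
  simpa using norm_integral_le_of_norm_le_const (μ := s v) (ae_of_all _ hg')

lemma integrable_utility_prod (F H : ProbabilityMeasure unitInterval)
    {s : unitInterval → Measure unitInterval} (hs : s ∈ biddingStrategies) :
    Integrable (fun p : unitInterval × unitInterval => ∫ b, utility b p.2 p.1 ∂(s p.1))
      ((F : Measure unitInterval).prod (H : Measure unitInterval)) := by
  refine Integrable.of_bound (Measurable.aestronglyMeasurable ?_) 1 (ae_of_all _ fun p =>
    abs_integral_strategy_le hs _ fun b => abs_utility_le _ _ _)
  refine measurable_integral_strategy (g := fun p b => utility b p.2 p.1) hs measurable_fst ?_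
  exact measurable_utility.comp (f := fun p : (unitInterval × unitInterval) × unitInterval =>
    (p.2, p.1.2, p.1.1)) (by fun_prop)

lemma expectedUtility_eq_integral_bids (F H : ProbabilityMeasure unitInterval)
    {s : unitInterval → Measure unitInterval} (hs : s ∈ biddingStrategies) :
    expectedUtility F s H = ∫ h, ∫ v, ∫ b, utility b h v ∂(s v) ∂(F : Measure unitInterval)
      ∂(H : Measure unitInterval) :=
  integral_prod_symm _ (integrable_utility_prod F H hs)

lemma integral_utility (H : ProbabilityMeasure unitInterval) (b v : unitInterval) :
    ∫ h, utility b h v ∂(H : Measure unitInterval) = ((v : ℝ) - b) * cdfI H b := by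
  have : (fun h => utility b h v) = (Iic b).indicator fun _ => (v : ℝ) - b := by
    ext h; simp [utility, indicator]
  rw [this, integral_indicator_const _ measurableSet_Iic, smul_eq_mul, mul_comm]
  rfl

lemma expectedUtility_eq_integral_cdf (F H : ProbabilityMeasure unitInterval)
    {s : unitInterval → Measure unitInterval} (hs : s ∈ biddingStrategies) :
    expectedUtility F s H =
      ∫ v, ∫ b, ((v : ℝ) - b) * cdfI H b ∂(s v) ∂(F : Measure unitInterval) := by
  rw [expectedUtility, integral_prod _ (integrable_utility_prod F H hs)]
  refine integral_congr_ae (ae_of_all _ fun v => ?_)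
  have := isProbabilityMeasure_of_mem hs v
  simp only
  rw [integral_integral_swap]
  · simp only [integral_utility]
  · exact Integrable.of_bound (Measurable.aestronglyMeasurable (measurable_utility.comp
      (f := fun p : unitInterval × unitInterval => (p.2, p.1, v)) (by fun_prop))) 1
      (ae_of_all _ fun p => abs_utility_le _ _ _)

lemma utility_le_max (b h v : unitInterval) : utility b h v ≤ max ((v : ℝ) - h) 0 := by
  rw [utility]
  split_ifs with hb
  · have : (h : ℝ) ≤ b := hb
    exact le_max_of_le_left (by linarith)
  · exact le_max_right _ _

lemma integrable_max_sub (F : ProbabilityMeasure unitInterval) (h : unitInterval) :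
    Integrable (fun v : unitInterval => max ((v : ℝ) - h) 0) (F : Measure unitInterval) :=
  integrable_unitInterval_of_bounded (by fun_prop) (C := 1) fun v => by
    rw [abs_of_nonneg (le_max_right _ _)]
    exact max_le (by linarith [v.2.2, h.2.1]) zero_le_one

lemma expectedUtility_diracProba (F : ProbabilityMeasure unitInterval) (h : unitInterval)
    {s : unitInterval → Measure unitInterval} (hs : s ∈ biddingStrategies) :
    expectedUtility F s (diracProba h) =
      ∫ v, ∫ b, utility b h v ∂(s v) ∂(F : Measure unitInterval) := by
  rw [expectedUtility_eq_integral_bids F _ hs]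
  exact integral_dirac _ h

lemma expectedUtility_diracProba_le (F : ProbabilityMeasure unitInterval) (h : unitInterval)
    {s : unitInterval → Measure unitInterval} (hs : s ∈ biddingStrategies) :
    expectedUtility F s (diracProba h) ≤
      ∫ v : unitInterval, max ((v : ℝ) - h) 0 ∂(F : Measure unitInterval) := by
  rw [expectedUtility_diracProba F h hs]
  refine integral_mono ?_ (integrable_max_sub F h) fun v => ?_
  · refine integrable_unitInterval_of_bounded
      (measurable_integral_strategy (g := fun v b => utility b h v) hs measurable_id ?_) (C := 1)
      fun v => abs_integral_strategy_le hs _ fun b => abs_utility_le _ _ _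
    exact measurable_utility.comp (f := fun p : unitInterval × unitInterval => (p.2, h, p.1))
      (by fun_prop)
  · have := isProbabilityMeasure_of_mem hs v
    calc ∫ b, utility b h v ∂(s v) ≤ ∫ b, max ((v : ℝ) - h) 0 ∂(s v) :=
          integral_mono (integrable_unitInterval_of_bounded (measurable_utility.comp
            (f := fun b : unitInterval => (b, h, v)) (by fun_prop)) fun b => abs_utility_le _ _ _)
            (integrable_const _) fun b => utility_le_max b h v
      _ = max ((v : ℝ) - h) 0 := by simp

lemma iSup_expectedUtility_diracProba (F : ProbabilityMeasure unitInterval) (h : unitInterval) :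
    ⨆ s : biddingStrategies, expectedUtility F s (diracProba h) =
      ∫ v : unitInterval, max ((v : ℝ) - h) 0 ∂(F : Measure unitInterval) := by
  -- Match `h` when that is profitable. Otherwise `h > v ≥ 0`, so the bid `0` loses.
  set β : unitInterval → unitInterval := fun v => if h ≤ v then h else 0 with hβ
  have hβm : Measurable β := Measurable.ite measurableSet_Ici measurable_const measurable_const
  have hmem : (fun v => Measure.dirac (β v)) ∈ biddingStrategies :=
    ⟨Kernel.deterministic β hβm, inferInstance, fun v => rfl⟩
  have hval : expectedUtility F (fun v => Measure.dirac (β v)) (diracProba h) =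
      ∫ v : unitInterval, max ((v : ℝ) - h) 0 ∂(F : Measure unitInterval) := by
    rw [expectedUtility_diracProba F h hmem]
    refine integral_congr_ae (ae_of_all _ fun v => ?_)
    simp only [integral_dirac, hβ, utility]
    by_cases hv : h ≤ v
    · have : (h : ℝ) ≤ v := hv
      simp only [hv, if_true, le_refl]
      exact (max_eq_left (by linarith)).symm
    · have h1 : (v : ℝ) < h := not_le.1 hv
      have h2 : ¬h ≤ 0 := not_le.2 (lt_of_le_of_lt v.2.1 (not_le.1 hv))
      simp only [hv, if_false, h2]
      exact (max_eq_right (by linarith)).symm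
  have hbdd : BddAbove (range fun s : biddingStrategies => expectedUtility F s (diracProba h)) :=
    ⟨_, by rintro _ ⟨s, rfl⟩; exact expectedUtility_diracProba_le F h s.2⟩
  have : Nonempty biddingStrategies := ⟨⟨_, hmem⟩⟩
  exact le_antisymm (ciSup_le fun s => expectedUtility_diracProba_le F h s.2)
    (hval ▸ le_ciSup hbdd (⟨_, hmem⟩ : biddingStrategies))

lemma fullInfoBenchmark_eq (F H : ProbabilityMeasure unitInterval) :
    fullInfoBenchmark F H =
      ∫ h : unitInterval, (survivalIntegral (cdfR F) 1 - survivalIntegral (cdfR F) h)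
        ∂(H : Measure unitInterval) := by
  simp only [fullInfoBenchmark, iSup_expectedUtility_diracProba, integral_max_sub]

/-! ### The strategy of a quantile-based bidder -/

lemma measurableSet_quantilesOf (F : ProbabilityMeasure unitInterval) (v : unitInterval) :
    MeasurableSet (quantilesOf F v) := measurable_genInv F (measurableSet_singleton v)

lemma countable_volume_quantilesOf_ne_zero (F : ProbabilityMeasure unitInterval) :
    {v | (volume : Measure unitInterval) (quantilesOf F v) ≠ 0}.Countable := by
  simp only [← pos_iff_ne_zero]
  exact Measure.countable_meas_level_set_pos (measurable_genInv F)

lemma quantileStrategy_mem (F : ProbabilityMeasure unitInterval)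
    {Q : unitInterval → unitInterval} (hQ : Measurable Q) :
    quantileStrategy F Q ∈ biddingStrategies := by
  have hm : Measurable (quantileStrategy F Q) := by
    -- The strategy differs from the deterministic one only at the countably many values with
    -- `λ(Y(v)) > 0`.
    refine Measurable.measurable_of_countable_ne (f := fun v => Measure.dirac (Q (cdfI F v)))
      (Measure.measurable_dirac.comp (hQ.comp (monotone_cdfI F).measurable))
      ((countable_volume_quantilesOf_ne_zero F).mono fun v hv => ?_)
    rw [mem_ofPred_eq] at hv ⊢
    contrapose! hv
    rw [quantileStrategy, if_pos hv]
  refine ⟨⟨quantileStrategy F Q, hm⟩, ⟨fun v => ?_⟩, fun v => rfl⟩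
  change IsProbabilityMeasure (quantileStrategy F Q v)
  rw [quantileStrategy]
  split_ifs with h
  · infer_instance
  · have := cond_isProbabilityMeasure (μ := (volume : Measure unitInterval)) h
    exact Measure.isProbabilityMeasure_map hQ.aemeasurable

lemma eq_cdfI_of_mem_quantilesOf {F : ProbabilityMeasure unitInterval} {v y : unitInterval}
    (hv : (volume : Measure unitInterval) (quantilesOf F v) = 0) (hy : y ∈ quantilesOf F v) :
    y = cdfI F v := by
  have hy : genInv F y = v := hy
  have h1 : y ≤ cdfI F v := (genInv_le_iff F y v).1 hy.le
  have h2 : Icc y (cdfI F v) ⊆ quantilesOf F v := fun t ht =>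
    le_antisymm ((genInv_le_iff F t v).2 ht.2) (hy ▸ monotone_genInv F ht.1)
  have h3 := measure_mono_null h2 hv
  rw [unitInterval.volume_Icc, ENNReal.ofReal_eq_zero] at h3
  exact le_antisymm h1 (Subtype.coe_le_coe.1 (by linarith))

/-- The value and the bid of a quantile-based bidder have the joint law of `(F⁻(y), Q(y))` for a
uniformly distributed quantile `y`. -/
lemma integral_quantileStrategy (F : ProbabilityMeasure unitInterval)
    {Q : unitInterval → unitInterval} (hQ : Measurable Q) {g : unitInterval → unitInterval → ℝ}
    (hg : Measurable (Function.uncurry g)) {C : ℝ} (hC : ∀ v b, |g v b| ≤ C) :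
    ∫ v, ∫ b, g v b ∂(quantileStrategy F Q v) ∂(F : Measure unitInterval) =
      ∫ y, g (genInv F y) (Q y) := by
  have hmem := quantileStrategy_mem F hQ
  set Ψ : unitInterval → ℝ := fun v => ∫ b, g v b ∂(quantileStrategy F Q v) with hΨ
  have hΨm : Measurable Ψ := measurable_integral_strategy hmem measurable_id hg
  have hΨC : ∀ v, |Ψ v| ≤ C := fun v => abs_integral_strategy_le hmem v (hC v)
  have hG := measurable_genInv F
  have hgm : Measurable fun y => g (genInv F y) (Q y) := hg.comp (hG.prodMk hQ)
  have hi1 : Integrable (fun y => Ψ (genInv F y)) volume :=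
    integrable_unitInterval_of_bounded (hΨm.comp hG) fun y => hΨC _
  have hi2 : Integrable (fun y => g (genInv F y) (Q y)) volume :=
    integrable_unitInterval_of_bounded hgm fun y => hC _ _
  conv_lhs => rw [← map_genInv F]
  rw [integral_map hG.aemeasurable hΨm.aestronglyMeasurable, ← sub_eq_zero,
    ← integral_sub hi1 hi2]
  -- On each of the countably many non-null sets `Y(v)`, the inner integral is the average of `g v
  -- (Q y)`, so the integrals agree. Outside their union the two integrands agree pointwise, since
  -- there `y = F(F⁻(y))`.
  set D := {v | (volume : Measure unitInterval) (quantilesOf F v) ≠ 0} with hD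
  have : Countable D := (countable_volume_quantilesOf_ne_zero F).to_subtype
  set A := ⋃ v : D, quantilesOf F v with hA
  have hAm : MeasurableSet A := MeasurableSet.iUnion fun v => measurableSet_quantilesOf F v
  have hi : Integrable (fun y => Ψ (genInv F y) - g (genInv F y) (Q y)) volume := hi1.sub hi2
  rw [← integral_add_compl hAm hi]
  have h1 : ∫ y in A, (Ψ (genInv F y) - g (genInv F y) (Q y)) = 0 := by
    rw [hA, integral_iUnion (s := fun v : D => quantilesOf F v) (fun v => measurableSet_quantilesOf F v) ?_
      hi.integrableOn]
    · refine (tsum_congr fun v => ?_).trans tsum_zero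
      rw [integral_sub hi1.integrableOn hi2.integrableOn, sub_eq_zero]
      have hv : (volume : Measure unitInterval) (quantilesOf F v) ≠ 0 := v.2
      have e1 : ∫ y in quantilesOf F v, Ψ (genInv F y) = ∫ y in quantilesOf F v, Ψ v :=
        setIntegral_congr_fun (measurableSet_quantilesOf F v) fun y hy => congrArg Ψ hy
      have e2 : ∫ y in quantilesOf F v, g (genInv F y) (Q y) =
          ∫ y in quantilesOf F v, g v (Q y) :=
        setIntegral_congr_fun (measurableSet_quantilesOf F v) fun y hy =>
          congrArg (fun w => g w (Q y)) hy
      have e3 : Ψ v = ((volume : Measure unitInterval) (quantilesOf F v)).toReal⁻¹ *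
          ∫ y in quantilesOf F v, g v (Q y) := by
        simp only [hΨ, quantileStrategy, if_neg hv]
        have hgv : Measurable (g v) := hg.comp measurable_prodMk_left
        rw [integral_map hQ.aemeasurable hgv.aestronglyMeasurable, ProbabilityTheory.cond, integral_smul_measure,
          ENNReal.toReal_inv, smul_eq_mul]
      rw [e1, e2, setIntegral_const, smul_eq_mul, e3, measureReal_def, ← mul_assoc,
        mul_inv_cancel₀ (ENNReal.toReal_ne_zero.2 ⟨hv, measure_ne_top _ _⟩), one_mul]
    · intro v w hvw
      refine disjoint_left.2 fun y hy hy' => hvw (Subtype.ext ?_)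
      exact (show genInv F y = v from hy).symm.trans hy'
  have h2 : ∫ y in Aᶜ, (Ψ (genInv F y) - g (genInv F y) (Q y)) = 0 := by
    refine (setIntegral_congr_fun hAm.compl (g := fun _ => (0 : ℝ)) fun y hy => ?_).trans (by simp)
    have hy0 : (volume : Measure unitInterval) (quantilesOf F (genInv F y)) = 0 := by
      by_contra h
      exact hy (mem_iUnion.2 ⟨⟨_, h⟩, rfl⟩)
    simp only [hΨ, quantileStrategy, if_pos hy0, integral_dirac]
    rw [← eq_cdfI_of_mem_quantilesOf hy0 rfl, sub_self]
  rw [h1, h2, add_zero]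

namespace IsIntegratedSolution

variable {F H : ProbabilityMeasure unitInterval} {Q : unitInterval → unitInterval}

/-! ### Best responses of the competing bidders -/

lemma intervalIntegrable_genInv_sub (hQ : IsIntegratedSolution F Q) (a b : ℝ) :
    IntervalIntegrable (fun s => realExt (genInv F) s - realExt Q s) volume a b :=
  (monotone_realExt (monotone_genInv F)).intervalIntegrable.sub
    (monotone_realExt hQ.strictMono.monotone).intervalIntegrable

/-- The equation at `t = 1`, combined with `∫ q = G(1)`, identifies the value of the game. -/
lemma survivalIntegral_apply_one (hQ : IsIntegratedSolution F Q) :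
    survivalIntegral (cdfR F) 1 - survivalIntegral (cdfR F) (Q 1) = ∫ t, (Q t : ℝ) := by
  have h := hQ.integral_eq 1
  rw [Set.Icc.coe_one, intervalIntegral.integral_sub
    (monotone_realExt (monotone_genInv F)).intervalIntegrable
    (monotone_realExt hQ.strictMono.monotone).intervalIntegrable, integral_realExt_genInv,
    ← integral_unitInterval] at h
  simp only [realExt_coe] at h
  linarith

lemma integral_utility_apply (hQ : IsIntegratedSolution F Q) (τ : unitInterval) :
    ∫ y, utility (Q y) (Q τ) (genInv F y) =
      survivalIntegral (cdfR F) (Q 1) - survivalIntegral (cdfR F) (Q τ) := by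
  have h1 : (fun y => utility (Q y) (Q τ) (genInv F y)) =
      (Icc τ 1).indicator fun y : unitInterval => realExt (genInv F) y - realExt Q y := by
    ext y
    have : y ∈ Icc τ 1 ↔ τ ≤ y := ⟨fun h => h.1, fun h => ⟨h, y.2.2⟩⟩
    simp only [utility, hQ.strictMono.le_iff_le, indicator, this, realExt_coe]
  rw [h1, integral_indicator measurableSet_Icc,
    setIntegral_unitInterval_Icc (fun s => realExt (genInv F) s - realExt Q s) τ 1 τ.2.2,
    hQ.integral_eq, hQ.integral_eq]
  exact (intervalIntegral.integral_interval_sub_left (hQ.intervalIntegrable_genInv_sub _ _)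
    (hQ.intervalIntegrable_genInv_sub _ _)).symm

/-- The regret of a quantile-based bidder against the deterministic highest competing bid `h`. -/
def pointRegret (F : ProbabilityMeasure unitInterval) (Q : unitInterval → unitInterval)
    (h : unitInterval) : ℝ :=
  survivalIntegral (cdfR F) 1 - survivalIntegral (cdfR F) h -
    ∫ y, utility (Q y) h (genInv F y)

lemma pointRegret_eq (hQ : IsIntegratedSolution F Q) {h : unitInterval} (hh : h ≤ Q 1) :
    pointRegret F Q h = ∫ t, (Q t : ℝ) := by
  obtain ⟨τ, rfl⟩ := hQ.exists_apply_eq hh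
  rw [pointRegret, hQ.integral_utility_apply, ← hQ.survivalIntegral_apply_one]
  ring

lemma pointRegret_le (hQ : IsIntegratedSolution F Q) (h : unitInterval) :
    pointRegret F Q h ≤ ∫ t, (Q t : ℝ) := by
  rcases le_or_gt h (Q 1) with hh | hh
  · exact (hQ.pointRegret_eq hh).le
  · have h0 : ∀ y, utility (Q y) h (genInv F y) = 0 := fun y =>
      if_neg (not_le.2 ((hQ.strictMono.monotone y.2.2).trans_lt hh))
    have h1 := survivalIntegral_mono (cdfR F).mono (cdfR_le_one F) (Subtype.coe_le_coe.2 hh.le)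
    rw [pointRegret, ← hQ.survivalIntegral_apply_one]
    simp only [h0, integral_zero]
    linarith

lemma measurable_bidUtility (hQ : IsIntegratedSolution F Q) :
    Measurable fun p : unitInterval × unitInterval => utility (Q p.2) p.1 (genInv F p.2) :=
  measurable_utility.comp (f := fun p : unitInterval × unitInterval =>
    (Q p.2, p.1, genInv F p.2)) ((hQ.continuous.measurable.comp measurable_snd).prodMk
      (measurable_fst.prodMk ((measurable_genInv F).comp measurable_snd)))

lemma integrable_integral_utility (hQ : IsIntegratedSolution F Q)
    (H : ProbabilityMeasure unitInterval) :
    Integrable (fun h => ∫ y, utility (Q y) h (genInv F y)) (H : Measure unitInterval) := by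
  refine integrable_unitInterval_of_bounded
    hQ.measurable_bidUtility.stronglyMeasurable.integral_prod_right'.measurable (C := 1)
    fun h => ?_
  have : ∀ y, ‖utility (Q y) h (genInv F y)‖ ≤ 1 := fun y => abs_utility_le _ _ _
  simpa using norm_integral_le_of_norm_le_const (μ := (volume : Measure unitInterval))
    (ae_of_all _ this)

lemma integrable_survivalIntegral_sub (F H : ProbabilityMeasure unitInterval) :
    Integrable (fun h : unitInterval =>
      survivalIntegral (cdfR F) 1 - survivalIntegral (cdfR F) h) (H : Measure unitInterval) := by
  have hc : Continuous fun h : unitInterval =>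
      survivalIntegral (cdfR F) 1 - survivalIntegral (cdfR F) h :=
    continuous_const.sub
      ((continuous_survivalIntegral (cdfR F).mono).comp continuous_subtype_val)
  exact hc.integrable_of_hasCompactSupport (HasCompactSupport.of_compactSpace _)

lemma integrable_pointRegret (hQ : IsIntegratedSolution F Q)
    (H : ProbabilityMeasure unitInterval) :
    Integrable (pointRegret F Q) (H : Measure unitInterval) :=
  (integrable_survivalIntegral_sub F H).sub (hQ.integrable_integral_utility H)

lemma fullInfoRegret_eq (hQ : IsIntegratedSolution F Q) (H : ProbabilityMeasure unitInterval) :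
    fullInfoRegret F (quantileStrategy F Q) H =
      ∫ h, pointRegret F Q h ∂(H : Measure unitInterval) := by
  have hQm := hQ.continuous.measurable
  rw [fullInfoRegret, fullInfoBenchmark_eq,
    expectedUtility_eq_integral_bids F H (quantileStrategy_mem F hQm)]
  have : ∀ h, ∫ v, ∫ b, utility b h v ∂(quantileStrategy F Q v) ∂(F : Measure unitInterval) =
      ∫ y, utility (Q y) h (genInv F y) := fun h =>
    integral_quantileStrategy F hQm (g := fun v b => utility b h v)
      (measurable_utility.comp (f := fun p : unitInterval × unitInterval => (p.2, h, p.1))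
        (by fun_prop)) fun v b => abs_utility_le _ _ _
  simp only [this]
  rw [← integral_sub (integrable_survivalIntegral_sub F H) (hQ.integrable_integral_utility H)]
  rfl

lemma fullInfoRegret_le (hQ : IsIntegratedSolution F Q) (H : ProbabilityMeasure unitInterval) :
    fullInfoRegret F (quantileStrategy F Q) H ≤ ∫ t, (Q t : ℝ) := by
  rw [hQ.fullInfoRegret_eq]
  calc ∫ h, pointRegret F Q h ∂(H : Measure unitInterval)
      ≤ ∫ h, (∫ t, (Q t : ℝ)) ∂(H : Measure unitInterval) :=
        integral_mono (hQ.integrable_pointRegret H) (integrable_const _) hQ.pointRegret_le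
    _ = ∫ t, (Q t : ℝ) := by simp

lemma fullInfoRegret_competingBid (hQ : IsIntegratedSolution F Q)
    (hH : ∀ t : unitInterval, (cdfI H (Q t) : ℝ) = winProb F Q t) :
    fullInfoRegret F (quantileStrategy F Q) H = ∫ t, (Q t : ℝ) := by
  have h1 : (H : Measure unitInterval).real (Iic (Q 1)) = 1 := by
    have := hH 1
    rwa [Set.Icc.coe_one, winProb_one] at this
  -- `H` lives on `[0, Q(1)]`, where the pointwise regret is constant.
  have h2 : ∀ᵐ h ∂(H : Measure unitInterval), h ∈ Iic (Q 1) := by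
    refine (mem_ae_iff_prob_eq_one measurableSet_Iic).2 ?_
    rwa [measureReal_def, ENNReal.toReal_eq_one_iff] at h1
  rw [hQ.fullInfoRegret_eq, integral_congr_ae (h2.mono fun h hh => hQ.pointRegret_eq hh)]
  simp

/-! ### The saddle point -/

lemma payoff_cdfI_le (hQ : IsIntegratedSolution F Q)
    (hH : ∀ t : unitInterval, (cdfI H (Q t) : ℝ) = winProb F Q t) (v b : unitInterval) :
    ((v : ℝ) - b) * cdfI H b ≤
      ((v : ℝ) - Q (cdfI F v)) * winProb F Q (cdfI F v) := by
  have key : ∀ τ : unitInterval, ((v : ℝ) - Q τ) * winProb F Q τ ≤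
      ((v : ℝ) - Q (cdfI F v)) * winProb F Q (cdfI F v) := fun τ =>
    hQ.payoff_le v (cdfI F v) τ (fun s hs => (genInv_le_iff F s v).2 hs.le)
      fun s hs => ((lt_genInv_iff F s v).2 hs).le
  rcases le_total b (Q 1) with hb | hb
  · obtain ⟨τ, rfl⟩ := hQ.exists_apply_eq hb
    rw [hH]
    exact key τ
  -- Bidding `Q(1)` already wins almost surely, so a higher bid only costs more.
  · have h1 : cdfI H (Q 1) = 1 := Subtype.ext (by rw [hH, Set.Icc.coe_one, winProb_one])
    have h2 : cdfI H b = 1 := le_antisymm (cdfI H b).2.2 (h1 ▸ monotone_cdfI H hb)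
    have h3 := key 1
    have h4 : (Q 1 : ℝ) ≤ b := hb
    rw [Set.Icc.coe_one, winProb_one] at h3
    rw [h2, Set.Icc.coe_one]
    linarith

lemma integral_payoff_quantileStrategy (hQ : IsIntegratedSolution F Q)
    (hH : ∀ t : unitInterval, (cdfI H (Q t) : ℝ) = winProb F Q t) (v : unitInterval) :
    ∫ b, ((v : ℝ) - b) * cdfI H b ∂(quantileStrategy F Q v) =
      ((v : ℝ) - Q (cdfI F v)) * winProb F Q (cdfI F v) := by
  have hm : Measurable fun b : unitInterval => ((v : ℝ) - b) * cdfI H b :=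
    (measurable_const.sub measurable_subtype_coe).mul
      (measurable_subtype_coe.comp (monotone_cdfI H).measurable)
  rw [quantileStrategy]
  split_ifs with hv
  · rw [integral_dirac, hH]
  · rw [integral_map hQ.continuous.measurable.aemeasurable hm.aestronglyMeasurable]
    have := cond_isProbabilityMeasure (μ := (volume : Measure unitInterval)) hv
    have h1 : ∀ᵐ y ∂(ProbabilityTheory.cond (volume : Measure unitInterval) (quantilesOf F v)),
        ((v : ℝ) - Q y) * cdfI H (Q y) =
          ((v : ℝ) - Q (cdfI F v)) * winProb F Q (cdfI F v) := by
      filter_upwards [ae_cond_mem (measurableSet_quantilesOf F v)] with y hy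
      have hy : genInv F y = v := hy
      -- Every `y ∈ Y(v)` is as good as `F(v)`: both maximize the payoff of the value `v`.
      refine le_antisymm (hQ.payoff_cdfI_le hH v (Q y)) ?_
      rw [hH]
      exact hQ.payoff_le v y _ (fun s hs => hy ▸ monotone_genInv F hs.le)
        fun s hs => hy ▸ monotone_genInv F (le_of_lt hs)
    rw [integral_congr_ae h1]
    simp

lemma expectedUtility_le (hQ : IsIntegratedSolution F Q)
    (hH : ∀ t : unitInterval, (cdfI H (Q t) : ℝ) = winProb F Q t)
    {s : unitInterval → Measure unitInterval} (hs : s ∈ biddingStrategies) :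
    expectedUtility F s H ≤ expectedUtility F (quantileStrategy F Q) H := by
  have hm : Measurable fun p : unitInterval × unitInterval => ((p.1 : ℝ) - p.2) * cdfI H p.2 :=
    ((measurable_subtype_coe.comp measurable_fst).sub
      (measurable_subtype_coe.comp measurable_snd)).mul
      (measurable_subtype_coe.comp ((monotone_cdfI H).measurable.comp measurable_snd))
  have hbound : ∀ v b : unitInterval, |((v : ℝ) - b) * cdfI H b| ≤ 1 := fun v b => by
    rw [abs_mul]
    refine mul_le_one₀ ?_ (abs_nonneg _) ?_
    · rw [abs_le]
      constructor <;> linarith [v.2.1, v.2.2, b.2.1, b.2.2]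
    · rw [abs_of_nonneg (cdfI H b).2.1]
      exact (cdfI H b).2.2
  have hint : ∀ s' ∈ biddingStrategies, Integrable
      (fun v : unitInterval => ∫ b, ((v : ℝ) - b) * cdfI H b ∂(s' v))
      (F : Measure unitInterval) := fun s' hs' =>
    integrable_unitInterval_of_bounded (measurable_integral_strategy
      (g := fun v b : unitInterval => ((v : ℝ) - b) * cdfI H b) hs' measurable_id hm)
      fun v => abs_integral_strategy_le hs' v (hbound v)
  have hQs := quantileStrategy_mem F hQ.continuous.measurable
  rw [expectedUtility_eq_integral_cdf F H hs, expectedUtility_eq_integral_cdf F H hQs]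
  refine integral_mono (hint s hs) (hint _ hQs) fun v => ?_
  have := isProbabilityMeasure_of_mem hs v
  simp only [hQ.integral_payoff_quantileStrategy hH v]
  calc ∫ b, ((v : ℝ) - b) * cdfI H b ∂(s v)
      ≤ ∫ b, ((v : ℝ) - Q (cdfI F v)) * winProb F Q (cdfI F v) ∂(s v) :=
        integral_mono (integrable_unitInterval_of_bounded (hm.comp measurable_prodMk_left)
          (hbound v)) (integrable_const _) fun b => hQ.payoff_cdfI_le hH v b
    _ = _ := by simp

end IsIntegratedSolution

end

theorem mainTheorem1 (F : ProbabilityMeasure unitInterval) (hF : cdfI F 0 = 0) :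
    ∃ (Q : unitInterval → unitInterval) (H : ProbabilityMeasure unitInterval),
      -- the quantile-based bidding strategy and its properties
      IsQuantileBased Q ∧
      SolvesIVP F Q ∧
      (∀ y : unitInterval, 0 < y → 0 < Q y ∧ Q y < genInv F y) ∧
      quantileStrategy F Q ∈ biddingStrategies ∧
      -- the explicit distribution of highest competing bids
      (∀ x : unitInterval, x ≤ Q 1 → (cdfI H x : ℝ) = competingBidCDF F Q x) ∧
      -- the saddle point
      (∀ s ∈ biddingStrategies,
        fullInfoRegret F (quantileStrategy F Q) H ≤ fullInfoRegret F s H) ∧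
      (∀ H' : ProbabilityMeasure unitInterval,
        fullInfoRegret F (quantileStrategy F Q) H' ≤ fullInfoRegret F (quantileStrategy F Q) H) ∧
      -- the minimax value
      (⨅ s : biddingStrategies, ⨆ H' : ProbabilityMeasure unitInterval,
        ((fullInfoRegret F s H' : ℝ) : EReal)) =
          ((fullInfoRegret F (quantileStrategy F Q) H : ℝ) : EReal) ∧
      fullInfoRegret F (quantileStrategy F Q) H = ∫ t : unitInterval, (Q t : ℝ) := by
  obtain ⟨Q, hQ⟩ := exists_isIntegratedSolution F hF
  obtain ⟨H, hH⟩ := hQ.exists_competingBid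
  have hQs := quantileStrategy_mem F hQ.continuous.measurable
  have hval := hQ.fullInfoRegret_competingBid hH
  have hbuyer : ∀ s ∈ biddingStrategies,
      fullInfoRegret F (quantileStrategy F Q) H ≤ fullInfoRegret F s H := fun s hs =>
    sub_le_sub_left (hQ.expectedUtility_le hH hs) _
  have hnature : ∀ H' : ProbabilityMeasure unitInterval,
      fullInfoRegret F (quantileStrategy F Q) H' ≤ fullInfoRegret F (quantileStrategy F Q) H :=
    fun H' => hval ▸ hQ.fullInfoRegret_le H'
  refine ⟨Q, H, hQ.isQuantileBased, hQ.solvesIVP, hQ.pos_and_lt, hQs, fun x hx => ?_, hbuyer,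
    hnature, ?_, hval⟩
  · obtain ⟨t, rfl⟩ := hQ.exists_apply_eq hx
    rw [hH, hQ.competingBidCDF_apply]
  · refine le_antisymm ?_ (le_iInf fun s => ?_)
    · exact (iInf_le _ (⟨_, hQs⟩ : biddingStrategies)).trans
        (iSup_le fun H' => EReal.coe_le_coe_iff.2 (hnature H'))
    · exact (EReal.coe_le_coe_iff.2 (hbuyer s s.2)).trans
        (le_iSup (fun H' => ((fullInfoRegret F s H' : ℝ) : EReal)) H)
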